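/- **Setting.** Let $\mathcal N=\{1,\dots,N\}$ be a set of users and let packets be elements of a finite field $\mathbb F_q$ with $q=2^L$, where $L>\log_2 N$. In each slot one packet is broadcast; in slot $l$ user $i$ receives it unaltered ($Z_{i,l}=0$) or sees an erasure symbol $E$ ($Z_{i,l}=1$). The vectors $\vec Z_l=(Z_{i,l})_{i\in\mathcal N}$ are i.i.d. over $l$, with an arbitrary joint law within a slot. For $\mathcal I\subseteq\mathcal N$ let $\epsilon_{\mathcal I}=\Pr(Z_i=1\ \forall i\in\mathcal I)$ and $\epsilon_i=\epsilon_{\{i\}}$; assume $\epsilon_i<1$ for all $i$. The channel is *symmetric* if $\epsilon_{\mathcal I}$ depends only on $|\mathcal I|$, and *spatially independent* if $\epsilon_{\mathcal I}=\prod_{i\in\mathcal I}\epsilon_i$ for all $\mathcal I$. **Codes.** An $(M_1,\dots,M_N,n)$ code with public feedback has messages $W_i$ from a set of size $M_i$, an encoder sending in slot $l\le n$ a packet that is a function of $\vec W$ and of all channel outputs of slots $1,\dots,l-1$, and decoders computing $\hat W_i$ (a message or a declared error) from the $n$ outputs of user $i$ and the erasures of all users. A rate $\vec R\ge\vec 0$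 (bits per slot) is achievable under a class of codes if there are codes $(\lceil 2^{nR_1}\rceil,\dots,\lceil 2^{nR_N}\rceil,n)$, $n\ge 0$, in the class for which the probability that $\hat W_i\ne W_i$ for some $i$, averaged over all message vectors, tends to $0$. The rate region of a class is the closure of the set of rates achievable under it; the capacity region is the closure of the set of rates achievable under some class. Put $$\mathcal C^{out}=\Big\{\vec R\ge \vec 0:\ \sum_{i=1}^N\frac{R_{\pi(i)}}{1-\epsilon_{\{\pi(1),\dots,\pi(i)\}}}\le L\ \text{ for every permutation }\pi\text{ of }\mathcal N\Big\}.$$ **Algorithm $\mathtt{CODE1}_{pub}$.** User $i$ has $K_i$ original packets. A packet is a linear combination $s$ of original packets; its coefficient vector $\vec b^{(i)}_s\in\mathbb F_q^{K_i}$ consists of its coefficients on the packets of user $i$. For $\varnothing\ne\mathcal S\subseteq\mathcal N$ there is a queue $Q_{\mathcal S}$, for $i\in\mathcal S$ an index $K^i_{\mathcal S}$ and a set $\mathcal B^{(i)}_{\mathcal S}$ of coefficient vectors; for each user there are a queue $Q_{D_i}$, an index $K_{D_i}$ and a set $\mathcal B_{D_i}$. Initially $Q_{\{i\}}$ holds the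 packets of user $i$, $K^i_{\{i\}}=K_i$, $\mathcal B^{(i)}_{\{i\}}$ is the standard basis, and everything else is empty or $0$. The queues are processed one after the other in a fixed order with $|\mathcal S|$ non-decreasing; $Q_{\mathcal S}$ is processed as long as $K^i_{\mathcal S}>0$ for some $i\in\mathcal S$. In each slot a combination $s=\sum_{p\in Q_{\mathcal S}}a_s(p)p$ is sent. If $\mathcal G$ is the set of users receiving it, then: 1. each $i\in\mathcal G$ adds $s$ to $Q_{D_i}$; 2. if $\mathcal G\subseteq\mathcal S$ and $K^i_{\mathcal S}=0$ for all $i\in\mathcal G$, then $s$ is retransmitted in the next slot (in particular if $\mathcal G=\varnothing$); 3. for $i\in\mathcal S\cap\mathcal G$ with $K^i_{\mathcal S}>0$: $K^i_{\mathcal S}$ decreases and $K_{D_i}$ increases by $1$; 4. if $\mathcal S\not\subseteq\mathcal G$ and $\mathcal G\not\subseteq\mathcal S$: $s$ is added to $Q_{\mathcal S\cup\mathcal G}$, and for $i\in\mathcal S\setminus\mathcal G$ with $K^i_{\mathcal S}>0$, $K^i_{\mathcal S}$ decreases and $K^i_{\mathcal S\cup\mathcal G}$ increases by $1$. Coefficients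 (not renewed for a retransmission) are produced by a procedure known to all users, from the state of the algorithm and the past erasures, which satisfies the following criterion. Suppose that for every user $i$ the sets $\mathcal B^{(i)}_{\mathcal I}$ $(\mathcal I\ni i)$ and $\mathcal B_{D_i}$ consist of coefficient vectors of packets in the corresponding queues, have $K^i_{\mathcal I}$ and $K_{D_i}$ elements, and have as union a basis $\mathcal B_i$ of $\mathbb F_q^{K_i}$. Then, with some $\hat b_i\in\mathcal B^{(i)}_{\mathcal S}$ picked for each $i\in\mathcal S$ with $K^i_{\mathcal S}>0$, for each such $i$ the set $\{\vec b^{(i)}_s\}\cup(\mathcal B_i\setminus\{\hat b_i\})$ is again a basis. For each such $i$, if $i$ receives $s$ (step 3), $\hat b_i$ is removed from $\mathcal B^{(i)}_{\mathcal S}$ and $\vec b^{(i)}_s$ is added to $\mathcal B_{D_i}$; if its index is moved (step 4), $\hat b_i$ is removed from $\mathcal B^{(i)}_{\mathcal S}$ and $\vec b^{(i)}_s$ is added to $\mathcal B^{(i)}_{\mathcal S\cup\mathcal G}$. An order of the queues together with such a procedure is called a rule. Each user $i$ replays the algorithm. For each packet $s$ it receives that was sent from a queue $Q_{\mathcal S}$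 with $i\in\mathcal S$, it knows $\vec b^{(i)}_s$ and a constant $c^{(i)}_s$ with $s=\sum_k b^{(i)}_s(k)u_k+c^{(i)}_s$, where $u_1,\dots,u_{K_i}$ are its packets, and it decodes by solving these linear equations. The constants are $0$ for the original packets in $Q_{\{i\}}$, they are combined linearly with the coefficients $a_s(p)$, and the constant of a received packet sent from $Q_{\mathcal S}$ with $i\notin\mathcal S$ is the packet itself. As a code of blocklength $n$, the messages of user $i$ are written injectively as $K_i=\lceil\log_q M_i\rceil$ packets (so $K_i=\lceil nR_i/L\rceil$ for $M_i=\lceil 2^{nR_i}\rceil$), and an error is declared if the algorithm has not terminated after $n$ slots (zero packets are sent after an earlier termination). For a fixed rule, $\mathtt{CODE1}_{pub}$ is the class of all these codes. **Ordered and fair rates.** For $i\in\mathcal S\subseteq\mathcal N$ let $\hat f^i_{\mathcal S}=\sum_{\mathcal H\subseteq\mathcal S\setminus\{i\}}\frac{(-1)^{|\mathcal S|-|\mathcal H|-1}}{1-\epsilon_{\mathcal N\setminus\mathcal H}}$. Let $\mathcal R_{ord}$ be the set of $\vec R\ge\vec 0$ for which there is a permutation $\tilde\pi$ of $\mathcal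 N$ such that, for every nonempty $\mathcal S\subseteq\mathcal N$, the element of $\mathcal S$ minimizing $\tilde\pi$ is a (not necessarily unique) maximizer of $i\mapsto\hat f^i_{\mathcal S}R_i$ on $\mathcal S$. Let $\mathcal R_{fair}=\{\vec R\ge\vec 0:\epsilon_1R_1\ge\dots\ge\epsilon_NR_N\}$. **Theorem.** Rules exist. Moreover: 1. If the channel is symmetric, then $\mathcal R_{ord}=\{\vec R:\vec R\ge\vec 0\}$, and $\mathtt{CODE1}_{pub}$ achieves capacity: for every rule, its rate region equals $\mathcal C^{out}$ and equals the capacity region of the channel with public feedback. 2. If the channel is spatially independent and $\epsilon_1\ge\dots\ge\epsilon_N$, then $\mathcal R_{fair}\subseteq\mathcal R_{ord}$ and, for every rule, the rate region of $\mathtt{CODE1}_{pub}$ contains $\mathcal R_{fair}\cap\mathcal C^{out}$. -/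

import Mathlib

open Filter Topology

/-! ### The broadcast packet erasure channel -/

/-- A memoryless broadcast packet erasure channel with `N` users. `prob Z` is the probability that,
in a slot, the set of users that erase the transmitted packet is exactly `Z`; the erasures of
different users in one slot may be arbitrarily correlated. No user erases every packet. -/
structure ErasureChannel (N : ℕ) where
  prob : Finset (Fin N) → ℝ
  prob_nonneg : ∀ Z, 0 ≤ prob Z
  prob_sum : ∑ Z, prob Z = 1
  erasure_lt_one : ∀ i : Fin N, ∑ Z with {i} ⊆ Z, prob Z < 1

namespace ErasureChannel

variable {N : ℕ}

/-- `ch.eps I` is the probability that all users of `I` erase the packet of a slot. -/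
def eps (ch : ErasureChannel N) (I : Finset (Fin N)) : ℝ := ∑ Z with I ⊆ Z, ch.prob Z

/-- The probability that all users of `I` erase depends on the size of `I` only. -/
def Symmetric (ch : ErasureChannel N) : Prop :=
  ∀ I J : Finset (Fin N), I.card = J.card → ch.eps I = ch.eps J

/-- Erasures of different users in one slot are independent. -/
def SpatiallyIndependent (ch : ErasureChannel N) : Prop :=
  ∀ I : Finset (Fin N), ch.eps I = ∏ i ∈ I, ch.eps {i}

/-- The set of one-sided fair rates. -/
def fairRates (ch : ErasureChannel N) : Set (Fin N → ℝ) :=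
  {R | 0 ≤ R ∧ Antitone fun i => ch.eps {i} * R i}

/-- The outer bound `C^out`, for packets of `L` bits; the set `{π 1, …, π i}` is the image
of `{1, …, i}` under `π`. -/
def outerBound (ch : ErasureChannel N) (L : ℕ) : Set (Fin N → ℝ) :=
  {R | 0 ≤ R ∧ ∀ π : Equiv.Perm (Fin N),
    ∑ i, R (π i) / (1 - ch.eps ((Finset.Iic i).image π)) ≤ L}

/-- The coefficient `f̂^i_S`, for `i ∈ S`. -/
noncomputable def fhat (ch : ErasureChannel N) (S : Finset (Fin N)) (i : Fin N) : ℝ :=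
  ∑ H ∈ (S.erase i).powerset, (-1) ^ (S.card - H.card - 1) / (1 - ch.eps (Finset.univ \ H))

/-- The set `R_ord`: some permutation `π` of the users is such that, for every `S`, the user of `S`
that minimizes `π` is a maximizer of `f̂^i_S R_i` over `S`. -/
def orderedRates (ch : ErasureChannel N) : Set (Fin N → ℝ) :=
  {R | 0 ≤ R ∧ ∃ π : Equiv.Perm (Fin N), ∀ S : Finset (Fin N), ∀ i ∈ S,
    (∀ j ∈ S, π i ≤ π j) → ∀ j ∈ S, ch.fhat S j * R j ≤ ch.fhat S i * R i}

end ErasureChannel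

/-! ### Channel codes with public feedback, achievable rates, capacity -/

/-- The channel output: `none` is the erasure symbol. -/
def channelOutput {N : ℕ} {F : Type*} (x : F) (Z : Finset (Fin N)) : Fin N → Option F :=
  fun i => if i ∈ Z then none else some x

/-- An `(M_1, …, M_N, n)` code with packets in `F` and public feedback. `enc l` gives the packet of
the slot number `l` (counted from `0`; only `l < n` matters) from the messages and all channel
outputs of the slots before; `dec i` is the decoder of user `i`, which sees its own `n` outputs and
the erasures of all users in all `n` slots, and may declare an error (`none`). -/
structure FeedbackCode {N : ℕ} (F : Type*) (M : Fin N → ℕ) (n : ℕ) where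
  enc : (l : ℕ) → ((i : Fin N) → Fin (M i)) → (Fin l → Fin N → Option F) → F
  dec : (i : Fin N) → (Fin n → Option F) → (Fin n → Finset (Fin N)) → Option (Fin (M i))

namespace FeedbackCode

variable {N : ℕ} {F : Type*} {M : Fin N → ℕ} {n : ℕ}

/-- The channel outputs of the first `l` slots, if `z` lists the sets of erasing users. -/
def outputs (c : FeedbackCode F M n) (w : (i : Fin N) → Fin (M i)) :
    (l : ℕ) → (Fin l → Finset (Fin N)) → (Fin l → Fin N → Option F)
  | 0, _ => fun t => t.elim0
  | l + 1, z =>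
      Fin.snoc (α := fun _ => Fin N → Option F) (c.outputs w l (fun t => z t.castSucc))
        (channelOutput (c.enc l w (c.outputs w l (fun t => z t.castSucc))) (z (Fin.last l)))

open Classical in
/-- The probability, given the messages `w`, that some user does not recover its message. -/
noncomputable def errorProb (c : FeedbackCode F M n) (ch : ErasureChannel N)
    (w : (i : Fin N) → Fin (M i)) : ℝ :=
  ∑ z : Fin n → Finset (Fin N),
    if ∃ i, c.dec i (fun t => c.outputs w n z t i) z ≠ some (w i) then ∏ t, ch.prob (z t) else 0

/-- The error probability averaged over all messages. -/
noncomputable def avgErrorProb (c : FeedbackCode F M n) (ch : ErasureChannel N) : ℝ :=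
  (∑ w, c.errorProb ch w) / (Fintype.card ((i : Fin N) → Fin (M i)) : ℝ)

end FeedbackCode

/-- A class of codes. -/
abbrev CodeClass (N : ℕ) (F : Type*) :=
  (M : Fin N → ℕ) → (n : ℕ) → Set (FeedbackCode F M n)

namespace ErasureChannel

variable {N : ℕ} {F : Type*}

/-- The rate `R` (information bits per slot) is achievable under the class `𝔠`. -/
def AchievableUnder (ch : ErasureChannel N) (𝔠 : CodeClass N F) (R : Fin N → ℝ) : Prop :=
  0 ≤ R ∧ ∃ c : (n : ℕ) → FeedbackCode F (fun i => ⌈(2 : ℝ) ^ ((n : ℝ) * R i)⌉₊) n,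
    (∀ n, c n ∈ 𝔠 _ n) ∧ Tendsto (fun n => (c n).avgErrorProb ch) atTop (𝓝 0)

/-- The rate region of a class of codes. -/
def rateRegion (ch : ErasureChannel N) (𝔠 : CodeClass N F) : Set (Fin N → ℝ) :=
  closure {R | ch.AchievableUnder 𝔠 R}

/-- The capacity region of the channel with public feedback and packet alphabet `F`. -/
def capacityRegion (ch : ErasureChannel N) (F : Type*) : Set (Fin N → ℝ) :=
  closure {R | ∃ 𝔠 : CodeClass N F, ch.AchievableUnder 𝔠 R}

end ErasureChannel

/-! ### The algorithm `CODE1_pub` -/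

namespace Code1

/-- A packet, written as a linear combination of all the original packets; user `i` has the
original packets `⟨i, k⟩` with `k < K i`. -/
abbrev Packet {N : ℕ} (F : Type*) (K : Fin N → ℕ) := ((i : Fin N) × Fin (K i)) → F

/-- The coefficient vector of a packet for user `i`. -/
def coeffVec {N : ℕ} {F : Type*} {K : Fin N → ℕ} (i : Fin N) (p : Packet F K) : Fin (K i) → F :=
  fun k => p ⟨i, k⟩

/-- What is chosen for a new transmission from a queue: the coefficient `coef j` of the packet
number `j` of the queue, and for every user `i` the vector of its basis set that is replaced. -/
structure Choice {N : ℕ} (F : Type*) (K : Fin N → ℕ) where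
  coef : ℕ → F
  pick : (i : Fin N) → Fin (K i) → F

/-- The data that the algorithm maintains. -/
structure State {N : ℕ} (F : Type*) (K : Fin N → ℕ) where
  /-- the virtual queues `Q_S` -/
  queue : Finset (Fin N) → List (Packet F K)
  /-- the queues `Q_{D_i}` of the packets received by user `i` -/
  queueD : Fin N → List (Packet F K)
  /-- the indices `K^i_S`, for `i ∈ S` -/
  idx : Finset (Fin N) → Fin N → ℕ
  /-- the indices `K_{D_i}` -/
  idxD : Fin N → ℕ
  /-- the sets `B^{(i)}_S` of coefficient vectors, for `i ∈ S` -/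
  base : Finset (Fin N) → (i : Fin N) → Set (Fin (K i) → F)
  /-- the sets `B_{D_i}` of coefficient vectors -/
  baseD : (i : Fin N) → Set (Fin (K i) → F)
  /-- the last choice, if the last packet has to be retransmitted -/
  held : Option (Choice F K)

section

variable {N : ℕ} {F : Type*} [Field F] {K : Fin N → ℕ}

/-- A set of vectors that is a basis. -/
def IsBasisSet {k : ℕ} (X : Set (Fin k → F)) : Prop :=
  LinearIndepOn F id X ∧ Submodule.span F X = ⊤

/-- The initial state: the queue `Q_{i}` holds the packets of user `i`, all other queues are
empty. -/
def initState (F : Type*) [Field F] (K : Fin N → ℕ) : State F K where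
  queue S := (List.finRange N).flatMap fun i =>
    if S = {i} then
      (List.finRange (K i)).map fun k => Pi.single (⟨i, k⟩ : (i : Fin N) × Fin (K i)) 1
    else []
  queueD _ := []
  idx S i := if S = {i} then K i else 0
  idxD _ := 0
  base S i := if S = {i} then Set.range fun k : Fin (K i) => Pi.single k 1 else ∅
  baseD _ := ∅
  held := none

/-- The queue `Q_S` still has to be processed. -/
def State.Active (st : State F K) (S : Finset (Fin N)) : Prop := ∃ i ∈ S, 0 < st.idx S i

/-- The packet that is sent from `Q_S` with coefficients `a`. -/
def State.combine (st : State F K) (S : Finset (Fin N)) (a : ℕ → F) : Packet F K :=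
  ∑ j : Fin (st.queue S).length, a j • (st.queue S).get j

/-- The union of `B_{D_i}` and of all the sets `B^{(i)}_S`. -/
def State.allBase (st : State F K) (i : Fin N) : Set (Fin (K i) → F) :=
  st.baseD i ∪ ⋃ S ∈ {S : Finset (Fin N) | i ∈ S}, st.base S i

/-- The basis sets consist of coefficient vectors of packets in the respective queues, have the
sizes given by the indices, and form together a basis, for every user. -/
def State.Consistent (st : State F K) : Prop :=
  ∀ i : Fin N,
    (∀ S : Finset (Fin N), i ∈ S →
      st.base S i ⊆ {b | ∃ p ∈ st.queue S, coeffVec i p = b} ∧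
      (st.base S i).ncard = st.idx S i) ∧
    st.baseD i ⊆ {b | ∃ p ∈ st.queueD i, coeffVec i p = b} ∧
    (st.baseD i).ncard = st.idxD i ∧
    IsBasisSet (st.allBase i)

/-- The packet sent from `Q_S` with the choice `d` replaces, for every user `i ∈ S` that still
expects tokens from `Q_S`, the picked vector of `B^{(i)}_S` in the basis. -/
def State.Suitable (st : State F K) (S : Finset (Fin N)) (d : Choice F K) : Prop :=
  ∀ i ∈ S, 0 < st.idx S i →
    d.pick i ∈ st.base S i ∧
    IsBasisSet (insert (coeffVec i (st.combine S d.coef)) (st.allBase i \ {d.pick i}))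

/-- User `i` gains a token when the packet sent from `Q_S` is received exactly by `G`. -/
def State.Gains (st : State F K) (S G : Finset (Fin N)) (i : Fin N) : Prop :=
  i ∈ S ∧ i ∈ G ∧ 0 < st.idx S i

/-- A packet sent from `Q_S` and received exactly by `G` is moved to `Q_{S ∪ G}`. -/
def Moves (S G : Finset (Fin N)) : Prop := (∃ i ∈ S, i ∉ G) ∧ ∃ j ∈ G, j ∉ S

/-- A token of user `i` is moved from `Q_S` to `Q_{S ∪ G}`. -/
def State.Shifts (st : State F K) (S G : Finset (Fin N)) (i : Fin N) : Prop :=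
  Moves S G ∧ i ∈ S ∧ i ∉ G ∧ 0 < st.idx S i

/-- The packet is retransmitted (this includes the case that nobody received it). -/
def State.Retransmits (st : State F K) (S G : Finset (Fin N)) : Prop :=
  G ⊆ S ∧ ∀ i ∈ G, st.idx S i = 0

open Classical in
/-- The actions `ACTFB1` after the transmission of a packet from `Q_S` with the choice `d`, when
`G` is the set of the users that received it. -/
noncomputable def State.update (st : State F K) (S : Finset (Fin N)) (d : Choice F K)
    (G : Finset (Fin N)) : State F K where
  queue T := if Moves S G ∧ T = S ∪ G then st.queue T ++ [st.combine S d.coef] else st.queue T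
  queueD i := if i ∈ G then st.queueD i ++ [st.combine S d.coef] else st.queueD i
  idx T i :=
    if T = S ∧ (st.Gains S G i ∨ st.Shifts S G i) then st.idx T i - 1
    else if T = S ∪ G ∧ st.Shifts S G i then st.idx T i + 1
    else st.idx T i
  idxD i := if st.Gains S G i then st.idxD i + 1 else st.idxD i
  base T i :=
    if T = S ∧ (st.Gains S G i ∨ st.Shifts S G i) then st.base T i \ {d.pick i}
    else if T = S ∪ G ∧ st.Shifts S G i then
      insert (coeffVec i (st.combine S d.coef)) (st.base T i)
    else st.base T i
  baseD i :=
    if st.Gains S G i then insert (coeffVec i (st.combine S d.coef)) (st.baseD i) else st.baseD i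
  held := if st.Retransmits S G then some d else none

end

/-- What the description of the algorithm leaves open: an order in which the queues are processed,
level by level, and a procedure, known to all users, that generates suitable coefficients from the
state of the algorithm and the erasures of the `t` previous slots. -/
structure Rule (N : ℕ) (F : Type*) [Field F] where
  order : List (Finset (Fin N))
  order_nodup : order.Nodup
  mem_order : ∀ S, S ∈ order ↔ S.Nonempty
  order_level : order.Pairwise fun S T => S.card ≤ T.card
  gen : (K : Fin N → ℕ) → (t : ℕ) → (Fin t → Finset (Fin N)) → State F K →
    Finset (Fin N) → Choice F K
  gen_suitable : ∀ (K : Fin N → ℕ) (t : ℕ) (z : Fin t → Finset (Fin N)) (st : State F K)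
    (S : Finset (Fin N)), st.Consistent → st.Active S → st.Suitable S (gen K t z st S)

section

variable {N : ℕ} {F : Type*} [Field F]

open Classical in
/-- The queue that is processed next: the first one in the order that still has to be processed
(packets and tokens only move to higher levels); `none` if the algorithm has terminated. -/
noncomputable def Rule.current (rule : Rule N F) {K : Fin N → ℕ} (st : State F K) :
    Option (Finset (Fin N)) :=
  rule.order.find? fun S => decide (st.Active S)

/-- The choice for the next transmission: no new coefficients are generated for a
retransmission. -/
def Rule.choice (rule : Rule N F) {K : Fin N → ℕ} {t : ℕ} (z : Fin t → Finset (Fin N))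
    (st : State F K) (S : Finset (Fin N)) : Choice F K :=
  st.held.getD (rule.gen K t z st S)

/-- The state after `t` slots, if `z` lists the sets of erasing users. -/
noncomputable def Rule.state (rule : Rule N F) (K : Fin N → ℕ) :
    (t : ℕ) → (Fin t → Finset (Fin N)) → State F K
  | 0, _ => initState F K
  | t + 1, z =>
      let past : Fin t → Finset (Fin N) := fun s => z s.castSucc
      let st := rule.state K t past
      match rule.current st with
      | none => st
      | some S => st.update S (rule.choice past st S) (z (Fin.last t))ᶜ

/-- The packet transmitted in slot `t` (counted from `0`); the zero packet after termination. -/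
noncomputable def Rule.sent (rule : Rule N F) (K : Fin N → ℕ) (t : ℕ)
    (z : Fin t → Finset (Fin N)) : Packet F K :=
  match rule.current (rule.state K t z) with
  | none => 0
  | some S => (rule.state K t z).combine S (rule.choice z (rule.state K t z) S).coef

open Classical in
/-- The constants `c^{(i)}_p` that user `i` knows for the packets `p` in the queues `Q_S` with
`i ∈ S`, in the order of the queue, after `t` slots with erasing sets `z` and outputs `y` of
user `i`. A packet sent from `Q_S` and stored in `Q_{S ∪ G}` has, if `i ∈ S`, the same linear
combination of the constants known before, and it is itself known to user `i` if `i ∈ G \ S`. -/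
noncomputable def Rule.known (rule : Rule N F) (K : Fin N → ℕ) (i : Fin N) :
    (t : ℕ) → (Fin t → Finset (Fin N)) → (Fin t → Option F) → Finset (Fin N) → List F
  | 0, _, _ => fun S => ((initState F K).queue S).map fun _ => 0
  | t + 1, z, y =>
      let past : Fin t → Finset (Fin N) := fun s => z s.castSucc
      let old := rule.known K i t past (fun s => y s.castSucc)
      let st := rule.state K t past
      let G := (z (Fin.last t))ᶜ
      match rule.current st with
      | none => old
      | some S => fun T =>
          if Moves S G ∧ T = S ∪ G then
            old T ++ [if i ∈ S then
                ∑ j : Fin (old S).length, (rule.choice past st S).coef j * (old S).get j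
              else (y (Fin.last t)).getD 0]
          else old T

/-- The values `u` of the packets of user `i` solve the linear equations that user `i` obtains from
the tokens it has received during `n` slots: a token `s` sent from `Q_S`, `i ∈ S`, with
coefficient vector `b` and constant `c`, gives the equation `∑ k, b k * u k + c = s`. -/
def Rule.Solves (rule : Rule N F) (K : Fin N → ℕ) (i : Fin N) {n : ℕ}
    (z : Fin n → Finset (Fin N)) (y : Fin n → Option F) (u : Fin (K i) → F) : Prop :=
  ∀ (t : Fin n) (S : Finset (Fin N)) (x : F),
    let past : Fin t → Finset (Fin N) := fun s => z (s.castLE t.is_lt.le)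
    let st := rule.state K t past
    let old := rule.known K i t past (fun s => y (s.castLE t.is_lt.le))
    rule.current st = some S → i ∈ S → y t = some x →
      ∑ k, coeffVec i (rule.sent K t past) k * u k +
        ∑ j : Fin (old S).length, (rule.choice past st S).coef j * (old S).get j = x

open Classical in
/-- The algorithm as a code of blocklength `n`: the message of user `i` is written as `K i` packets
by means of `φ i`, and an error is declared if the algorithm has not terminated after `n` slots. -/
noncomputable def Rule.code (rule : Rule N F) {M : Fin N → ℕ} (K : Fin N → ℕ)
    (φ : (i : Fin N) → Fin (M i) ↪ (Fin (K i) → F)) (n : ℕ) : FeedbackCode F M n where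
  enc l w y :=
    ∑ u : (i : Fin N) × Fin (K i),
      rule.sent K l (fun t => Finset.univ.filter fun i => y t i = none) u * φ u.1 (w u.1) u.2
  dec i y z :=
    if h : rule.current (rule.state K n z) = none ∧ ∃! m, rule.Solves K i z y (φ i m) then
      some h.2.choose
    else none

/-- The class of codes `CODE1_pub` with a given rule: `M i` messages are written as the least
sufficient number `⌈log_q (M i)⌉` of packets in the alphabet of size `q`. -/
def Rule.codes (rule : Rule N F) [Fintype F] : CodeClass N F := fun M n =>
  {c | ∃ φ : (i : Fin N) → Fin (M i) ↪ (Fin (Nat.clog (Fintype.card F) (M i)) → F),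
    c = rule.code (fun i => Nat.clog (Fintype.card F) (M i)) φ n}

end

end Code1

/-!
The three assertions rest on four facts.

*Rules exist.* New coefficients for a queue are suitable as soon as, for every user who still
expects tokens, the new coefficient vector avoids the span of the basis without the replaced
vector. This excludes at most `N` proper subspaces of the space of all coefficients, and fewer
than `|F|` proper subspaces do not cover it (`State.exists_suitable`).

*Decoding.* The exchange property keeps, for every user, a basis that is distributed over the
queues (`State.Valid`, `Rule.valid_state`). At termination the whole basis consists of coefficient
vectors of received packets whose constants the user knows (`Rule.known_eq`), so the linear
equations have exactly one solution (`Rule.solves_iff`). An error occurs only if the algorithm has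
not terminated in time (`Rule.avgErrorProb_code_le`).

*Duration.* Followed in isolation, a token of user `i` walks from `Q_T` to `Q_{T ∪ G}` until user
`i` receives its packet, and it spends `f̂^i_S` slots in `Q_S` on average. The slots that user `i`
has already been busy in `Q_S` and those still expected form together a martingale with bounded
increments, so by Chebyshev's inequality user `i` is busy in `Q_S` for `K_i f̂^i_S + o(n)` slots
(`Rule.forecast`, `Rule.overrunProb_le`). The processing of `Q_S` takes as long as its busiest user
(`Rule.served_invariant`); for an ordered rate, the busiest user is always the first one of `S` in
a fixed order, and by Möbius inversion the sum of these durations is one of the sums that define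
the outer bound (`ErasureChannel.sum_leading`). Hence the rate region contains all ordered rates in
the outer bound (`Rule.inter_subset_rateRegion`).

*Converse.* Given the erasures, all that is received is a function of the uniformly distributed
messages, so that entropies become sums of logarithms of class sizes of partitions of the set of
message vectors (`Setoid.ambiguity`). If the users `π 1, …, π k` pool their outputs, they learn
from the packet of a slot with probability `1 - ε_{π 1, …, π k}`, independently of the packet, and
conditioning reduces entropy; with Fano's inequality the bound telescopes along `π`
(`FeedbackCode.sum_log_le`). This works for every channel.

For a symmetric channel `f̂^i_S` does not depend on `i ∈ S`, so that ordering the users by rate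
shows that every rate is ordered. For a spatially independent channel `f̂^i_S` is the sum over `t`
of the probabilities that after `t` slots exactly the users of `S` other than `i` have received a
packet, and two such series are compared term by term.
-/

/-! ### Existence of a rule -/

namespace Code1

section BasisSets

variable {F : Type*} [Field F] {k : ℕ}

theorem IsBasisSet.finite {X : Set (Fin k → F)} (hX : IsBasisSet X) : X.Finite :=
  LinearIndependent.setFinite hX.1

theorem IsBasisSet.insert_diff {X : Set (Fin k → F)} (hX : IsBasisSet X) {b x : Fin k → F}
    (hb : b ∈ X) (hx : x ∉ Submodule.span F (X \ {b})) : IsBasisSet (insert x (X \ {b})) := by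
  refine ⟨(hX.1.mono Set.sdiff_subset).id_insert hx, ?_⟩
  have hXb : insert b (X \ {b}) = X := by simp [hb]
  have hb' : b ∈ Submodule.span F (insert x (X \ {b})) := by
    refine mem_span_insert_exchange ?_ hx
    rw [hXb, hX.2]; trivial
  have hle : Submodule.span F (insert b (X \ {b})) ≤ Submodule.span F (insert x (X \ {b})) := by
    rw [Submodule.span_le, Set.insert_subset_iff]
    exact ⟨hb', fun y hy => Submodule.subset_span (Set.mem_insert_of_mem _ hy)⟩
  rw [hXb, hX.2] at hle
  exact top_le_iff.1 hle

theorem IsBasisSet.notMem_span_diff {X : Set (Fin k → F)} (hX : IsBasisSet X) {b : Fin k → F}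
    (hb : b ∈ X) : b ∉ Submodule.span F (X \ {b}) := by
  simpa using hX.1.notMem_span hb

/-- In an exchange that leads from a basis to a basis, the new vector is really new. -/
theorem IsBasisSet.notMem_diff {X : Set (Fin k → F)} (hX : IsBasisSet X) {b x : Fin k → F}
    (hb : b ∈ X) (h : IsBasisSet (insert x (X \ {b}))) : x ∉ X \ {b} := by
  intro hx
  rw [Set.insert_eq_of_mem hx] at h
  apply hX.notMem_span_diff hb
  rw [h.2]; trivial

theorem isBasisSet_range_single :
    IsBasisSet (Set.range fun j : Fin k => (Pi.single j 1 : Fin k → F)) := by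
  have e : (fun j : Fin k => (Pi.single j 1 : Fin k → F)) = Pi.basisFun F (Fin k) := by
    ext j; simp
  rw [e]
  exact ⟨(Pi.basisFun F (Fin k)).linearIndependent.linearIndepOn_id, Module.Basis.span_eq _⟩

end BasisSets

section Exists

variable {N : ℕ} {F : Type*} [Field F] {K : Fin N → ℕ}

/-- The coefficient vector of the packet sent from a queue, as a linear map of the coefficients. -/
def State.combineLin (st : State F K) (S : Finset (Fin N)) (i : Fin N) :
    (ℕ → F) →ₗ[F] (Fin (K i) → F) where
  toFun a := coeffVec i (st.combine S a)
  map_add' a b := by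
    ext k; simp [coeffVec, State.combine, Finset.sum_apply, add_mul, Finset.sum_add_distrib]
  map_smul' c a := by
    ext k; simp [coeffVec, State.combine, Finset.sum_apply, Finset.mul_sum, mul_assoc]

theorem State.combine_single (st : State F K) (S : Finset (Fin N))
    (j : Fin (st.queue S).length) :
    st.combine S (Pi.single (j : ℕ) 1) = (st.queue S).get j := by
  unfold State.combine
  rw [Finset.sum_eq_single j]
  · simp
  · intro j' _ hj'
    rw [Pi.single_eq_of_ne (by simpa [Fin.ext_iff] using hj'), zero_smul]
  · simp

/-- Suitable coefficients avoid, for every active user `i`, the coefficients whose packet lies in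
the span of the basis without the replaced vector; fewer than `|F|` proper subspaces do not
cover the space of all coefficients. -/
theorem State.exists_suitable [Fintype F] (hN : N < Fintype.card F) (st : State F K)
    (S : Finset (Fin N)) (hst : st.Consistent) : ∃ d, st.Suitable S d := by
  classical
  have hb : ∀ i : Fin N, ∃ b : Fin (K i) → F, i ∈ S → 0 < st.idx S i → b ∈ st.base S i := by
    intro i
    by_cases h : i ∈ S ∧ 0 < st.idx S i
    · have := (((hst i).1 S h.1).2 ▸ h.2 : 0 < (st.base S i).ncard)
      obtain ⟨b, hb⟩ := Set.nonempty_of_ncard_ne_zero this.ne'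
      exact ⟨b, fun _ _ => hb⟩
    · exact ⟨0, fun h1 h2 => absurd ⟨h1, h2⟩ h⟩
  choose b hb using hb
  let P : Fin N → Submodule F (ℕ → F) := fun i =>
    if i ∈ S ∧ 0 < st.idx S i then
      (Submodule.span F (st.allBase i \ {b i})).comap (st.combineLin S i) else ⊥
  have hall : ∀ i ∈ S, 0 < st.idx S i → b i ∈ st.allBase i := fun i hi h0 =>
    Or.inr (Set.mem_biUnion (show S ∈ {S : Finset (Fin N) | i ∈ S} from hi) (hb i hi h0))
  have hP : ∀ i, P i ≠ ⊤ := by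
    intro i
    by_cases h : i ∈ S ∧ 0 < st.idx S i
    · obtain ⟨p, hp, hpb⟩ := ((hst i).1 S h.1).1 (hb i h.1 h.2)
      obtain ⟨j, hj⟩ := List.get_of_mem hp
      intro htop
      have : (Pi.single (j : ℕ) 1 : ℕ → F) ∈ P i := by rw [htop]; trivial
      simp only [P, if_pos h, Submodule.mem_comap] at this
      change coeffVec i (st.combine S _) ∈ _ at this
      rw [st.combine_single S j, hj, hpb] at this
      exact (hst i).2.2.2.notMem_span_diff (hall i h.1 h.2) this
    · simp only [P, if_neg h]
      exact bot_ne_top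
  have hcov := Submodule.iUnion_ssubset_of_forall_ne_top_of_card_lt Finset.univ P hP
    (by simpa using hN)
  obtain ⟨a, -, ha⟩ := Set.exists_of_ssubset hcov
  refine ⟨⟨a, b⟩, fun i hi h0 => ⟨hb i hi h0, (hst i).2.2.2.insert_diff (hall i hi h0) ?_⟩⟩
  intro hmem
  apply ha
  refine Set.mem_biUnion (Finset.mem_coe.2 (Finset.mem_univ i)) ?_
  simp only [P, if_pos (And.intro hi h0)]
  exact hmem

theorem Rule.nonempty [Fintype F] (hN : N < Fintype.card F) : Nonempty (Rule N F) := by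
  classical
  let l : List (Finset (Fin N)) := (Finset.univ.filter fun S : Finset (Fin N) => S.Nonempty).toList
  refine ⟨⟨l.mergeSort fun S T => decide (S.card ≤ T.card), ?_, ?_, ?_,
    fun K t z st S => if h : ∃ d, st.Suitable S d then h.choose else ⟨0, fun _ => 0⟩, ?_⟩⟩
  · exact (List.mergeSort_perm _ _).nodup_iff.2 (Finset.nodup_toList _)
  · intro S
    simp [l]
  · have := List.pairwise_mergeSort (le := fun S T : Finset (Fin N) => decide (S.card ≤ T.card))
      (fun a b c h1 h2 => by simp only [decide_eq_true_eq] at *; omega)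
      (fun a b => by simp only [Bool.or_eq_true, decide_eq_true_eq]; omega) l
    simpa using this
  · intro K t z st S hst _
    have h := st.exists_suitable hN S hst
    simp only [dif_pos h]
    exact h.choose_spec

end Exists

/-! ### Invariants of the algorithm -/

section Transfer

variable {ι V : Type*}

open Classical in
/-- In a family of sets, the element `p` is removed from the set `B a` and `x` is added to `B b`. -/
def transfer (B : ι → Set V) (a b : ι) (p x : V) : ι → Set V := fun c =>
  if c = a then B c \ {p} else if c = b then insert x (B c) else B c

theorem mem_transfer {B : ι → Set V} {a b : ι} {p x : V} {c : ι} {v : V} (hab : a ≠ b) :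
    v ∈ transfer B a b p x c ↔ (v ∈ B c ∧ (c = a → v ≠ p)) ∨ (c = b ∧ v = x) := by
  unfold transfer
  split_ifs with h1 h2
  · subst h1; simp [hab]
  · subst h2; simp [h1, or_comm]
  · simp [h1, h2]

variable {B : ι → Set V} {a b : ι} {p x : V}

theorem iUnion_transfer (hB : Pairwise (Function.onFun Disjoint B)) (hab : a ≠ b) (hp : p ∈ B a) :
    ⋃ c, transfer B a b p x c = insert x ((⋃ c, B c) \ {p}) := by
  ext v
  simp only [Set.mem_iUnion, mem_transfer hab, Set.mem_insert_iff, Set.mem_sdiff,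
    Set.mem_singleton_iff]
  constructor
  · rintro ⟨c, ⟨h1, h2⟩ | ⟨-, h⟩⟩
    · refine Or.inr ⟨⟨c, h1⟩, ?_⟩
      rintro rfl
      by_cases hc : c = a
      · exact h2 hc rfl
      · exact Set.disjoint_left.1 (hB hc) h1 hp
    · exact Or.inl h
  · rintro (h | ⟨⟨c, hc⟩, hv⟩)
    · exact ⟨b, Or.inr ⟨rfl, h⟩⟩
    · exact ⟨c, Or.inl ⟨hc, fun _ => hv⟩⟩

theorem pairwise_disjoint_transfer (hB : Pairwise (Function.onFun Disjoint B)) (hab : a ≠ b)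
    (hp : p ∈ B a) (hx : x ∉ (⋃ c, B c) \ {p}) :
    Pairwise (Function.onFun Disjoint (transfer B a b p x)) := by
  have key : ∀ c, c ≠ b → x ∉ transfer B a b p x c := by
    intro c hc h
    rw [mem_transfer hab] at h
    rcases h with ⟨h1, h2⟩ | ⟨h, -⟩
    · refine hx ⟨Set.mem_iUnion.2 ⟨c, h1⟩, ?_⟩
      rintro rfl
      by_cases hc : c = a
      · exact h2 hc rfl
      · exact Set.disjoint_left.1 (hB hc) h1 hp
    · exact hc h
  intro c c' hcc
  refine Set.disjoint_left.2 fun v h h' => ?_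
  have h0 := h
  have h0' := h'
  rw [mem_transfer hab] at h h'
  rcases h with ⟨h1, h2⟩ | ⟨h1, h2⟩
  · rcases h' with ⟨h1', h2'⟩ | ⟨h1', h2'⟩
    · exact Set.disjoint_left.1 (hB hcc) h1 h1'
    · subst h2'
      exact key c (h1' ▸ hcc) h0
  · subst h2
    exact key c' (h1 ▸ hcc.symm) h0'

theorem ncard_transfer (hfin : ∀ c, (B c).Finite) (hB : Pairwise (Function.onFun Disjoint B))
    (hab : a ≠ b) (hp : p ∈ B a) (hx : x ∉ (⋃ c, B c) \ {p}) [DecidableEq ι] (c : ι) :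
    (transfer B a b p x c).ncard =
      if c = a then (B c).ncard - 1 else if c = b then (B c).ncard + 1 else (B c).ncard := by
  unfold transfer
  split_ifs with h1 h2
  · subst h1
    exact Set.ncard_sdiff_singleton_of_mem hp
  · subst h2
    refine Set.ncard_insert_of_notMem (fun h => hx ⟨Set.mem_iUnion.2 ⟨c, h⟩, ?_⟩) (hfin c)
    rintro rfl
    exact Set.disjoint_left.1 (hB h1) h hp
  · rfl

end Transfer

section Invariant

variable {N : ℕ} {F : Type*} {K : Fin N → ℕ}

/-- The parts of the basis of user `i`: `none` stands for `B_{D_i}`, and `some S` for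
`B^{(i)}_S`, which is relevant for `i ∈ S` only. -/
def State.cell (st : State F K) (i : Fin N) : Option (Finset (Fin N)) → Set (Fin (K i) → F)
  | none => st.baseD i
  | some S => {b | i ∈ S ∧ b ∈ st.base S i}

/-- The index that counts the elements of `State.cell`. -/
def State.tokens (st : State F K) (i : Fin N) : Option (Finset (Fin N)) → ℕ
  | none => st.idxD i
  | some S => if i ∈ S then st.idx S i else 0

/-- The queue that belongs to `State.cell`. -/
def State.cellQueue (st : State F K) (i : Fin N) : Option (Finset (Fin N)) → List (Packet F K)
  | none => st.queueD i
  | some S => st.queue S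

theorem State.allBase_eq_iUnion [Field F] (st : State F K) (i : Fin N) :
    st.allBase i = ⋃ c, st.cell i c := by
  ext v
  simp only [State.allBase, Set.mem_union, Set.mem_iUnion, Set.mem_ofPred_eq, Option.exists,
    State.cell, exists_prop]

variable [Field F]

theorem State.consistent_iff (st : State F K) :
    st.Consistent ↔ ∀ i, (∀ c, ∀ b ∈ st.cell i c, ∃ p ∈ st.cellQueue i c, coeffVec i p = b) ∧
      (∀ c, (st.cell i c).ncard = st.tokens i c) ∧ IsBasisSet (⋃ c, st.cell i c) := by
  have hcell : ∀ (i : Fin N) (S : Finset (Fin N)), i ∈ S → st.cell i (some S) = st.base S i :=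
    fun i S hi => by ext b; simp [State.cell, hi]
  refine forall_congr' fun i => ?_
  rw [st.allBase_eq_iUnion]
  constructor
  · rintro ⟨h1, h2, h3, h4⟩
    refine ⟨?_, ?_, h4⟩
    · rintro (_ | S) b hb
      · exact h2 hb
      · exact (h1 S hb.1).1 hb.2
    · rintro (_ | S)
      · exact h3
      · by_cases hi : i ∈ S
        · rw [hcell i S hi, (h1 S hi).2]; simp [State.tokens, hi]
        · have : st.cell i (some S) = ∅ := by ext b; simp [State.cell, hi]
          rw [this]; simp [State.tokens, hi]
  · rintro ⟨h1, h2, h4⟩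
    refine ⟨fun S hi => ⟨fun b hb => h1 (some S) b ⟨hi, hb⟩, ?_⟩, fun b hb => h1 none b hb,
      h2 none, h4⟩
    have := h2 (some S)
    rw [hcell i S hi] at this
    simpa [State.tokens, hi] using this

/-- The invariant of the algorithm: besides consistency, the parts of a basis are disjoint, and
the packets of `Q_S` involve only original packets of users in `S`. -/
structure State.Valid (st : State F K) : Prop where
  consistent : st.Consistent
  disjoint : ∀ i, Pairwise (Function.onFun Disjoint (st.cell i))
  support : ∀ S, ∀ p ∈ st.queue S, ∀ i ∉ S, coeffVec i p = 0

theorem State.coeffVec_combine_eq_zero {st : State F K} (hst : st.Valid) {S : Finset (Fin N)}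
    {i : Fin N} (hi : i ∉ S) (a : ℕ → F) : coeffVec i (st.combine S a) = 0 := by
  ext k
  simp only [coeffVec, State.combine, Finset.sum_apply, Pi.smul_apply, Pi.zero_apply]
  refine Finset.sum_eq_zero fun j _ => ?_
  have := congrFun (hst.support S _ (List.get_mem (st.queue S) j) i hi) k
  simp only [coeffVec, Pi.zero_apply] at this
  rw [this, smul_zero]

open Classical in
/-- An action either leaves the basis of a user as it is, or moves one token from `Q_S` to
another queue, the new queue being one that the transmitted packet has joined. -/
theorem State.cell_update (st : State F K) (S : Finset (Fin N)) (d : Choice F K)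
    (G : Finset (Fin N)) (i : Fin N) :
    ((st.update S d G).cell i = st.cell i ∧ (st.update S d G).tokens i = st.tokens i) ∨
    (i ∈ S ∧ 0 < st.idx S i ∧ ∃ b, some S ≠ b ∧
      (st.update S d G).cell i =
        transfer (st.cell i) (some S) b (d.pick i) (coeffVec i (st.combine S d.coef)) ∧
      (st.update S d G).tokens i =
        (fun c => if c = some S then st.tokens i c - 1 else if c = b then st.tokens i c + 1
          else st.tokens i c) ∧
      st.combine S d.coef ∈ (st.update S d G).cellQueue i b) := by
  by_cases hg : st.Gains S G i
  · have hs : ¬ st.Shifts S G i := fun h => h.2.2.1 hg.2.1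
    refine Or.inr ⟨hg.1, hg.2.2, none, by simp, ?_, ?_, ?_⟩
    · funext c
      rcases c with _ | T
      · ext b; simp [State.cell, State.update, transfer, hg]
      · by_cases hT : T = S
        · subst hT
          ext b; simp [State.cell, State.update, transfer, hg, hg.1]
        · ext b; simp [State.cell, State.update, transfer, hs, hT]
    · funext c
      rcases c with _ | T
      · simp [State.tokens, State.update, hg]
      · by_cases hT : T = S
        · subst hT
          simp [State.tokens, State.update, hg, hg.1]
        · simp [State.tokens, State.update, hs, hT]
    · simp [State.cellQueue, State.update, hg.2.1]
  · by_cases hs : st.Shifts S G i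
    · have hne : S ≠ S ∪ G := by
        obtain ⟨j, hjG, hjS⟩ := hs.1.2
        intro h
        exact hjS (h ▸ Finset.mem_union_right _ hjG)
      have hiU : i ∈ S ∪ G := Finset.mem_union_left _ hs.2.1
      refine Or.inr ⟨hs.2.1, hs.2.2.2, some (S ∪ G), by simpa using hne, ?_, ?_, ?_⟩
      · funext c
        rcases c with _ | T
        · ext b; simp [State.cell, State.update, transfer, hg]
        · by_cases hT : T = S
          · subst hT
            ext b; simp [State.cell, State.update, transfer, hs, hs.2.1]
          · by_cases hT' : T = S ∪ G
            · subst hT'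
              ext b
              simp [State.cell, State.update, transfer, hs, hiU, Ne.symm hne, -Finset.mem_union,
                -Finset.union_eq_left]
            · ext b; simp [State.cell, State.update, transfer, hT, hT']
      · funext c
        rcases c with _ | T
        · simp [State.tokens, State.update, hg]
        · by_cases hT : T = S
          · subst hT
            simp [State.tokens, State.update, hs, hs.2.1]
          · by_cases hT' : T = S ∪ G
            · subst hT'
              simp [State.tokens, State.update, hs, hiU, Ne.symm hne, -Finset.mem_union,
                -Finset.union_eq_left]
            · simp [State.tokens, State.update, hT, hT']
      · simp [State.cellQueue, State.update, hs.1]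
    · refine Or.inl ⟨?_, ?_⟩ <;> funext c <;> rcases c with _ | T <;>
        simp [State.cell, State.tokens, State.update, hg, hs]

theorem State.cellQueue_subset_update (st : State F K) (S : Finset (Fin N)) (d : Choice F K)
    (G : Finset (Fin N)) (i : Fin N) (c : Option (Finset (Fin N))) :
    st.cellQueue i c ⊆ (st.update S d G).cellQueue i c := by
  rcases c with _ | T <;> simp only [State.cellQueue, State.update] <;> split_ifs <;> simp

theorem State.Valid.finite_cell {st : State F K} (hst : st.Valid) (i : Fin N)
    (c : Option (Finset (Fin N))) : (st.cell i c).Finite :=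
  (st.consistent_iff.1 hst.consistent i).2.2.finite.subset (Set.subset_iUnion _ c)

theorem State.Valid.update {st : State F K} (hst : st.Valid) {S : Finset (Fin N)}
    {d : Choice F K} (hd : st.Suitable S d) (G : Finset (Fin N)) : (st.update S d G).Valid := by
  classical
  have hc := st.consistent_iff.1 hst.consistent
  have key : ∀ i, ((∀ c, ∀ b ∈ (st.update S d G).cell i c,
      ∃ p ∈ (st.update S d G).cellQueue i c, coeffVec i p = b) ∧
      (∀ c, ((st.update S d G).cell i c).ncard = (st.update S d G).tokens i c) ∧
      IsBasisSet (⋃ c, (st.update S d G).cell i c)) ∧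
      Pairwise (Function.onFun Disjoint ((st.update S d G).cell i)) := by
    intro i
    obtain ⟨h1, h2, h3⟩ := hc i
    have hmono := fun c => st.cellQueue_subset_update S d G i c
    rcases st.cell_update S d G i with ⟨e1, e2⟩ | ⟨hi, h0, b, hb, e1, e2, hq⟩
    · rw [e1, e2]
      refine ⟨⟨fun c v hv => ?_, h2, h3⟩, hst.disjoint i⟩
      obtain ⟨p, hp, hpv⟩ := h1 c v hv
      exact ⟨p, hmono c hp, hpv⟩
    · obtain ⟨hpick, hbasis⟩ := hd i hi h0
      have hp : d.pick i ∈ st.cell i (some S) := ⟨hi, hpick⟩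
      rw [st.allBase_eq_iUnion] at hbasis
      have hx := h3.notMem_diff (Set.mem_iUnion.2 ⟨_, hp⟩) hbasis
      rw [e1, e2]
      refine ⟨⟨fun c v hv => ?_, fun c => ?_, ?_⟩, ?_⟩
      · rw [mem_transfer hb] at hv
        rcases hv with ⟨hv, -⟩ | ⟨rfl, rfl⟩
        · obtain ⟨p, hp, hpv⟩ := h1 c v hv
          exact ⟨p, hmono c hp, hpv⟩
        · exact ⟨_, hq, rfl⟩
      · rw [ncard_transfer (hst.finite_cell i) (hst.disjoint i) hb hp hx, h2]
      · rw [iUnion_transfer (hst.disjoint i) hb hp]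
        exact hbasis
      · exact pairwise_disjoint_transfer (hst.disjoint i) hb hp hx
  refine ⟨(State.consistent_iff _).2 fun i => (key i).1, fun i => (key i).2, ?_⟩
  intro T p hp i hi
  simp only [State.update] at hp
  split_ifs at hp with h
  · rcases List.mem_append.1 hp with hp | hp
    · exact hst.support T p hp i hi
    · rw [List.mem_singleton.1 hp]
      exact st.coeffVec_combine_eq_zero hst
        (fun h' => hi (h.2 ▸ Finset.mem_union_left _ h')) _
  · exact hst.support T p hp i hi

theorem mem_queue_initState {S : Finset (Fin N)} {p : Packet F K} :
    p ∈ (initState F K).queue S ↔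
      ∃ (i : Fin N) (k : Fin (K i)), S = {i} ∧
        Pi.single (⟨i, k⟩ : (i : Fin N) × Fin (K i)) 1 = p := by
  simp only [initState, List.mem_flatMap, List.mem_finRange, true_and]
  refine exists_congr fun i => ?_
  split_ifs with h <;> simp [h]

theorem coeffVec_single_self (i : Fin N) (k : Fin (K i)) :
    coeffVec i (Pi.single (⟨i, k⟩ : (i : Fin N) × Fin (K i)) 1 : Packet F K) = Pi.single k 1 := by
  ext k'
  by_cases h : k' = k
  · subst h; simp [coeffVec]
  · rw [Pi.single_eq_of_ne h, coeffVec, Pi.single_eq_of_ne]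
    simpa using h

theorem coeffVec_single_of_ne {i j : Fin N} (h : i ≠ j) (k : Fin (K j)) :
    coeffVec i (Pi.single (⟨j, k⟩ : (i : Fin N) × Fin (K i)) 1 : Packet F K) = 0 := by
  ext k'
  rw [coeffVec, Pi.single_eq_of_ne, Pi.zero_apply]
  intro h'
  exact h (congrArg Sigma.fst h')

theorem valid_initState : (initState F K).Valid := by
  classical
  have hcell : ∀ i c, (initState F K).cell i c =
      if c = some {i} then Set.range fun k : Fin (K i) => (Pi.single k 1 : Fin (K i) → F)
      else ∅ := by
    intro i c
    rcases c with _ | S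
    · simp [State.cell, initState]
    · by_cases h : S = {i}
      · subst h; ext b; simp [State.cell, initState]
      · ext b; simp [State.cell, initState, h]
  refine ⟨(State.consistent_iff _).2 fun i => ⟨?_, ?_, ?_⟩, ?_, ?_⟩
  · intro c b hb
    rw [hcell] at hb
    split_ifs at hb with h
    · obtain ⟨k, rfl⟩ := hb
      subst h
      exact ⟨_, mem_queue_initState.2 ⟨i, k, rfl, rfl⟩, coeffVec_single_self i k⟩
    · exact hb.elim
  · intro c
    rw [hcell]
    split_ifs with h
    · subst h
      have hinj : Function.Injective fun k : Fin (K i) => (Pi.single k 1 : Fin (K i) → F) :=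
        fun k k' h => by
          by_contra hne
          have := congrFun h k
          simp [Pi.single_eq_of_ne hne] at this
      rw [← Set.image_univ, Set.ncard_image_of_injective _ hinj, Set.ncard_univ]
      simp [State.tokens, initState]
    · rcases c with _ | S
      · simp [State.tokens, initState]
      · have : S ≠ {i} := fun h' => h (by rw [h'])
        simp [State.tokens, initState, this]
  · have : ⋃ c, (initState F K).cell i c =
        Set.range fun k : Fin (K i) => (Pi.single k 1 : Fin (K i) → F) := by
      ext b
      simp only [Set.mem_iUnion, hcell]
      constructor
      · rintro ⟨c, hc⟩
        split_ifs at hc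
        · exact hc
        · exact hc.elim
      · intro hb
        exact ⟨some {i}, by simpa using hb⟩
    rw [this]
    exact isBasisSet_range_single
  · intro i c c' hcc
    simp only [Function.onFun, hcell]
    split_ifs with h h'
    · exact absurd (h.trans h'.symm) hcc
    all_goals simp
  · intro S p hp i hi
    obtain ⟨j, k, rfl, rfl⟩ := mem_queue_initState.1 hp
    exact coeffVec_single_of_ne (by simpa using hi) k

variable (rule : Rule N F)

theorem Rule.active_of_current {st : State F K} {S : Finset (Fin N)}
    (h : rule.current st = some S) : st.Active S := by
  simpa using List.find?_some h

theorem Rule.current_congr {st st' : State F K} (h : st.idx = st'.idx) :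
    rule.current st = rule.current st' := by
  unfold Rule.current State.Active
  rw [h]

theorem Rule.current_eq_none_iff {st : State F K} :
    rule.current st = none ↔ ∀ S i, i ∈ S → st.idx S i = 0 := by
  simp only [Rule.current, List.find?_eq_none, rule.mem_order, decide_eq_true_iff]
  constructor
  · intro h S i hi
    by_contra h0
    exact h S ⟨i, hi⟩ ⟨i, hi, Nat.pos_of_ne_zero h0⟩
  · rintro h S - ⟨i, hi, h0⟩
    exact h0.ne' (h S i hi)

/-- While a packet is retransmitted, nothing but the queues `Q_{D_i}` changes. -/
theorem State.update_of_retransmits {st : State F K} {S G : Finset (Fin N)} {d : Choice F K}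
    (h : st.Retransmits S G) :
    (st.update S d G).idx = st.idx ∧ (st.update S d G).base = st.base ∧
      (st.update S d G).baseD = st.baseD ∧ (st.update S d G).queue = st.queue := by
  have hg : ∀ i, ¬ st.Gains S G i := fun i hi => hi.2.2.ne' (h.2 i hi.2.1)
  have hm : ¬ Moves S G := fun ⟨_, j, hj, hjS⟩ => hjS (h.1 hj)
  have hs : ∀ i, ¬ st.Shifts S G i := fun i hi => hm hi.1
  refine ⟨?_, ?_, ?_, ?_⟩
  · funext T i; simp [State.update, hg, hs]
  · funext T i; simp [State.update, hg, hs]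
  · funext i; simp [State.update, hg]
  · funext T; simp [State.update, hm]

theorem State.Suitable.congr {st st' : State F K} {S : Finset (Fin N)} {d : Choice F K}
    (h : st.Suitable S d) (h1 : st'.idx = st.idx) (h2 : st'.base = st.base)
    (h3 : st'.baseD = st.baseD) (h4 : st'.queue = st.queue) : st'.Suitable S d := by
  have hall : ∀ i, st'.allBase i = st.allBase i := fun i => by simp [State.allBase, h2, h3]
  have hq : ∀ (q : Finset (Fin N) → List (Packet F K)), q = st.queue →
      ∑ j : Fin (q S).length, d.coef j • (q S).get j = st.combine S d.coef := by
    rintro q rfl; rfl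
  have hcomb : st'.combine S d.coef = st.combine S d.coef := hq _ h4
  intro i hi h0
  rw [h1] at h0
  rw [hall, hcomb, h2]
  exact h i hi h0

/-- Besides the invariant, a choice that is kept for a retransmission remains suitable for the
queue that is processed. -/
theorem Rule.valid_state_and_held (t : ℕ) (z : Fin t → Finset (Fin N)) :
    (rule.state K t z).Valid ∧ ∀ d, (rule.state K t z).held = some d →
      ∀ S, rule.current (rule.state K t z) = some S → (rule.state K t z).Suitable S d := by
  induction t with
  | zero => exact ⟨valid_initState, fun d hd => by simp [Rule.state, initState] at hd⟩
  | succ t ih =>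
    obtain ⟨hv, hh⟩ := ih fun s => z s.castSucc
    rw [Rule.state]
    set st := rule.state K t fun s => z s.castSucc with hst
    cases hcur : rule.current st with
    | none => exact ⟨hv, hh⟩
    | some S =>
      have hd : st.Suitable S (rule.choice (fun s => z s.castSucc) st S) := by
        unfold Rule.choice
        cases hheld : st.held with
        | none => exact rule.gen_suitable K t _ st S hv.consistent (rule.active_of_current hcur)
        | some d => exact hh d hheld S hcur
      refine ⟨hv.update hd _, fun d hd' S' hS' => ?_⟩
      simp only [State.update] at hd'
      split_ifs at hd' with hr
      obtain ⟨h1, h2, h3, h4⟩ :=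
        State.update_of_retransmits (d := rule.choice (fun s => z s.castSucc) st S) hr
      rw [rule.current_congr h1, hcur] at hS'
      obtain rfl := Option.some.inj hS'
      rw [← Option.some.inj hd']
      exact hd.congr h1 h2 h3 h4

theorem Rule.valid_state (t : ℕ) (z : Fin t → Finset (Fin N)) : (rule.state K t z).Valid :=
  (rule.valid_state_and_held t z).1

end Invariant

end Code1

/-! ### Decoding after termination -/

namespace FeedbackCode

variable {N : ℕ} {F : Type*} {M : Fin N → ℕ} {n : ℕ}

/-- The packet of slot `t` depends only on the erasures before `t`, which turns the recursion for
the outputs into a formula for every slot. -/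
theorem outputs_apply (c : FeedbackCode F M n) (w : (i : Fin N) → Fin (M i)) {l : ℕ}
    (z : Fin l → Finset (Fin N)) (t : Fin l) :
    c.outputs w l z t =
      channelOutput (c.enc t w (c.outputs w t fun s => z (s.castLE t.is_lt.le))) (z t) := by
  induction l with
  | zero => exact t.elim0
  | succ l ih =>
    rw [outputs]
    refine Fin.lastCases ?_ (fun t => ?_) t
    · rw [Fin.snoc_last]; rfl
    · rw [Fin.snoc_castSucc, ih]; rfl

end FeedbackCode

namespace Code1

variable {N : ℕ} {F : Type*} [Field F] {K : Fin N → ℕ}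

/-- The element of `F` that a packet stands for, if `U` lists the original packets. -/
def value (U : (i : Fin N) × Fin (K i) → F) (p : Packet F K) : F := ∑ u, p u * U u

/-- The constant of a packet for user `i`: the part of its value that stems from the original
packets of the other users. -/
def interference (U : (i : Fin N) × Fin (K i) → F) (i : Fin N) : Packet F K →ₗ[F] F where
  toFun p := value U p - ∑ k, coeffVec i p k * U ⟨i, k⟩
  map_add' p q := by
    simp only [value, coeffVec, Pi.add_apply, add_mul, Finset.sum_add_distrib]; ring
  map_smul' c p := by
    simp only [value, coeffVec, Pi.smul_apply, smul_eq_mul, mul_assoc, ← Finset.mul_sum,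
      RingHom.id_apply]
    ring

theorem value_eq (U : (i : Fin N) × Fin (K i) → F) (i : Fin N) (p : Packet F K) :
    value U p = ∑ k, coeffVec i p k * U ⟨i, k⟩ + interference U i p := by
  simp [interference]

theorem interference_eq_value {U : (i : Fin N) × Fin (K i) → F} {i : Fin N} {p : Packet F K}
    (hp : coeffVec i p = 0) : interference U i p = value U p := by
  simp [interference, hp]

theorem interference_single (U : (i : Fin N) × Fin (K i) → F) (i : Fin N) (k : Fin (K i)) :
    interference U i (Pi.single ⟨i, k⟩ 1) = 0 := by
  have h1 : value U (Pi.single (⟨i, k⟩ : (i : Fin N) × Fin (K i)) 1) = U ⟨i, k⟩ := by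
    classical
    rw [value, Finset.sum_eq_single ⟨i, k⟩]
    · simp
    · intro u _ hu; rw [Pi.single_eq_of_ne hu, zero_mul]
    · simp
  have h2 := value_eq U i (Pi.single ⟨i, k⟩ 1)
  rw [coeffVec_single_self, h1, Finset.sum_eq_single k] at h2
  · simpa using h2
  · intro k' _ hk; rw [Pi.single_eq_of_ne hk, zero_mul]
  · simp

theorem sum_coef_map {A : Type*} [AddCommMonoid A] [Module F A] (f : A →ₗ[F] F) (a : ℕ → F)
    {q : List A} {q' : List F} (h : q' = q.map f) :
    ∑ j : Fin q'.length, a j * q'.get j = f (∑ j : Fin q.length, a j • q.get j) := by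
  subst h
  rw [map_sum]
  refine Fintype.sum_equiv (finCongr (by simp)) _ _ fun j => ?_
  simp

variable (rule : Rule N F)

/-- `y` lists the outputs of user `i`, if the original packets are `U` and `z` lists the sets of
erasing users. -/
def Rule.IsOutput (rule : Rule N F) (U : (i : Fin N) × Fin (K i) → F) (i : Fin N) {t : ℕ}
    (z : Fin t → Finset (Fin N)) (y : Fin t → Option F) : Prop :=
  ∀ s : Fin t, y s = channelOutput
    (value U (rule.sent K s fun r => z (r.castLE s.is_lt.le))) (z s) i

theorem Rule.sent_of_current {t : ℕ} {z : Fin t → Finset (Fin N)} {S : Finset (Fin N)}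
    (h : rule.current (rule.state K t z) = some S) :
    rule.sent K t z =
      (rule.state K t z).combine S (rule.choice z (rule.state K t z) S).coef := by
  rw [Rule.sent, h]

/-- A user computes the constants correctly: for the packets of the queues `Q_T`, `i ∈ T`, they
are the interference of the other users. -/
theorem Rule.known_eq (U : (i : Fin N) × Fin (K i) → F) (i : Fin N) {t : ℕ}
    (z : Fin t → Finset (Fin N)) (y : Fin t → Option F) (hy : rule.IsOutput U i z y)
    (T : Finset (Fin N)) (hT : i ∈ T) :
    rule.known K i t z y T = ((rule.state K t z).queue T).map (interference U i) := by
  induction t generalizing T with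
  | zero =>
    simp only [Rule.known, Rule.state]
    refine List.map_congr_left fun p hp => ?_
    obtain ⟨j, k, rfl, rfl⟩ := mem_queue_initState.1 hp
    obtain rfl := Finset.mem_singleton.1 hT
    rw [interference_single]
  | succ t ih =>
    have ih' := ih (fun s => z s.castSucc) (fun s => y s.castSucc) fun s => hy s.castSucc
    have hlast := hy (Fin.last t)
    change y (Fin.last t) = channelOutput
      (value U (rule.sent K t fun r => z r.castSucc)) (z (Fin.last t)) i at hlast
    have hvalid := rule.valid_state (K := K) t fun s => z s.castSucc
    rw [Rule.known, Rule.state]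
    cases hcur : rule.current (rule.state K t fun s => z s.castSucc) with
    | none => exact ih' T hT
    | some S =>
      simp only [State.update]
      rw [rule.sent_of_current hcur] at hlast
      split_ifs with hm hi
      · rw [ih' T hT, List.map_append, List.map_singleton,
          sum_coef_map (interference U i) _ (ih' S hi)]
        rfl
      · have hiz : i ∉ z (Fin.last t) := by
          have := hm.2 ▸ hT
          simpa [hi] using this
        rw [ih' T hT, List.map_append, List.map_singleton, hlast,
          interference_eq_value (State.coeffVec_combine_eq_zero hvalid hi _)]
        simp [channelOutput, hiz]
      · exact ih' T hT

/-- The vectors of `B_{D_i}` give equations to user `i`: they belong to packets that it received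
while they were sent from a queue `Q_S` with `i ∈ S`. -/
theorem Rule.exists_received_of_mem_baseD {i : Fin N} {n : ℕ} (z : Fin n → Finset (Fin N))
    {b : Fin (K i) → F} (hb : b ∈ (rule.state K n z).baseD i) :
    ∃ (t : Fin n) (S : Finset (Fin N)),
      rule.current (rule.state K t fun s => z (s.castLE t.is_lt.le)) = some S ∧ i ∈ S ∧ i ∉ z t ∧
        coeffVec i (rule.sent K t fun s => z (s.castLE t.is_lt.le)) = b := by
  induction n with
  | zero => exact hb.elim
  | succ n ih =>
    have ih' : b ∈ (rule.state K n fun s => z s.castSucc).baseD i → ∃ (t : Fin (n + 1))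
        (S : Finset (Fin N)),
        rule.current (rule.state K t fun s => z (s.castLE t.is_lt.le)) = some S ∧ i ∈ S ∧
          i ∉ z t ∧ coeffVec i (rule.sent K t fun s => z (s.castLE t.is_lt.le)) = b := by
      intro h
      obtain ⟨t, S, h⟩ := ih _ h
      exact ⟨t.castSucc, S, h⟩
    rw [Rule.state] at hb
    cases hcur : rule.current (rule.state K n fun s => z s.castSucc) with
    | none => exact ih' (by simpa only [hcur] using hb)
    | some S =>
      simp only [hcur, State.update] at hb
      split_ifs at hb with hg
      · rcases hb with rfl | hb
        · refine ⟨Fin.last n, S, hcur, hg.1, by simpa using hg.2.1, ?_⟩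
          change coeffVec i (rule.sent K n fun s => z s.castSucc) = _
          rw [rule.sent_of_current hcur]
        · exact ih' hb
      · exact ih' hb

/-- After termination `B_{D_i}` is the whole basis, so that the packets received by user `i`
determine the original ones. -/
theorem Rule.span_baseD {i : Fin N} {n : ℕ} {z : Fin n → Finset (Fin N)}
    (h : rule.current (rule.state K n z) = none) :
    Submodule.span F ((rule.state K n z).baseD i) = ⊤ := by
  have hv := rule.valid_state (K := K) n z
  have hb := (hv.consistent i).2.2.2
  have hc := ((rule.state K n z).consistent_iff.1 hv.consistent i).2.1
  have hall : (rule.state K n z).allBase i ⊆ (rule.state K n z).baseD i := by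
    rw [State.allBase_eq_iUnion]
    refine Set.iUnion_subset fun c => ?_
    rcases c with _ | S
    · exact subset_rfl
    · have : (rule.state K n z).cell i (some S) = ∅ := by
        rw [← Set.ncard_eq_zero (hv.finite_cell i _), hc, State.tokens]
        split_ifs with hi
        · exact rule.current_eq_none_iff.1 h S i hi
        · rfl
      rw [this]; exact Set.empty_subset _
  rw [eq_top_iff, ← hb.2]
  exact Submodule.span_mono hall

/-- After termination the equations of user `i` have exactly one solution. -/
theorem Rule.solves_iff {U : (i : Fin N) × Fin (K i) → F} {i : Fin N} {n : ℕ}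
    {z : Fin n → Finset (Fin N)} {y : Fin n → Option F} (hy : rule.IsOutput U i z y)
    (h : rule.current (rule.state K n z) = none) (u : Fin (K i) → F) :
    rule.Solves K i z y u ↔ u = fun k => U ⟨i, k⟩ := by
  have hconst : ∀ (t : Fin n) (S : Finset (Fin N)),
      rule.current (rule.state K t fun s => z (s.castLE t.is_lt.le)) = some S → i ∈ S →
      let past : Fin t → Finset (Fin N) := fun s => z (s.castLE t.is_lt.le)
      let old := rule.known K i t past (fun s => y (s.castLE t.is_lt.le))
      ∑ j : Fin (old S).length, (rule.choice past (rule.state K t past) S).coef j * (old S).get j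
        = interference U i (rule.sent K t past) := by
    intro t S hS hi
    have hk := rule.known_eq U i (fun s => z (s.castLE t.is_lt.le))
      (fun s => y (s.castLE t.is_lt.le)) (fun s => hy (s.castLE t.is_lt.le)) S hi
    simp only
    rw [sum_coef_map (interference U i) _ hk, rule.sent_of_current hS]
    rfl
  constructor
  · intro hu
    have horth : ∀ b ∈ Submodule.span F ((rule.state K n z).baseD i),
        ∑ k, b k * (u k - U ⟨i, k⟩) = 0 := by
      intro b hb
      induction hb using Submodule.span_induction with
      | mem b hb =>
        obtain ⟨t, S, hcur, hi, hz, rfl⟩ := rule.exists_received_of_mem_baseD z hb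
        have hyt := hy t
        simp only [channelOutput, if_neg hz] at hyt
        have := hu t S _ hcur hi hyt
        simp only [hconst t S hcur hi] at this
        rw [value_eq U i, add_left_inj] at this
        simp only [mul_sub, Finset.sum_sub_distrib]
        rw [this, sub_self]
      | zero => simp
      | add x y _ _ hx hy => simp [add_mul, Finset.sum_add_distrib, hx, hy]
      | smul a x _ hx => simp [mul_assoc, ← Finset.mul_sum, hx]
    rw [rule.span_baseD h] at horth
    funext k
    have := horth (Pi.single k 1) trivial
    rw [Finset.sum_eq_single k] at this
    · simpa [sub_eq_zero] using this
    · intro k' _ hk; rw [Pi.single_eq_of_ne hk, zero_mul]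
    · simp
  · rintro rfl t S x past st old hcur hi hx
    have hyt := hy t
    rw [hx] at hyt
    simp only [channelOutput] at hyt
    split_ifs at hyt
    rw [Option.some.inj hyt, value_eq U i]
    exact congrArg _ (hconst t S hcur hi)

section Code

variable {M : Fin N → ℕ} (φ : (i : Fin N) → Fin (M i) ↪ (Fin (K i) → F)) (n : ℕ)
  (w : (i : Fin N) → Fin (M i))

/-- The encoder reads the erasures off the channel outputs, and so runs the algorithm. -/
theorem Rule.enc_code {t : ℕ} (z : Fin t → Finset (Fin N)) :
    (rule.code K φ n).enc t w ((rule.code K φ n).outputs w t z) =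
      value (fun u => φ u.1 (w u.1) u.2) (rule.sent K t z) := by
  have : (fun s => Finset.univ.filter fun i =>
      (rule.code K φ n).outputs w t z s i = none) = z := by
    funext s
    ext i
    rw [FeedbackCode.outputs_apply]
    simp [channelOutput]
  simp only [value]
  conv_rhs => rw [← this]
  simp only [Rule.code]
  congr! 3

theorem Rule.isOutput_code (z : Fin n → Finset (Fin N)) (i : Fin N) :
    rule.IsOutput (fun u => φ u.1 (w u.1) u.2) i z
      fun t => (rule.code K φ n).outputs w n z t i := by
  intro s
  simp only
  rw [FeedbackCode.outputs_apply, rule.enc_code]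

theorem Rule.dec_code {z : Fin n → Finset (Fin N)}
    (h : rule.current (rule.state K n z) = none) (i : Fin N) :
    (rule.code K φ n).dec i (fun t => (rule.code K φ n).outputs w n z t i) z = some (w i) := by
  have hs := fun m => rule.solves_iff (rule.isOutput_code φ n w z i) h (φ i m)
  have huniq : ∀ m, rule.Solves K i z (fun t => (rule.code K φ n).outputs w n z t i) (φ i m) →
      m = w i := fun m hm => (φ i).injective ((hs m).1 hm)
  have hex : ∃! m, rule.Solves K i z (fun t => (rule.code K φ n).outputs w n z t i) (φ i m) :=
    ⟨w i, (hs (w i)).2 rfl, huniq⟩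
  have hdec : ∀ y, (∃! m, rule.Solves K i z y (φ i m)) →
      ∃ h' : ∃! m, rule.Solves K i z y (φ i m),
        (rule.code K φ n).dec i y z = some h'.choose := fun y hy => ⟨hy, by
    simp only [Rule.code]
    rw [dif_pos ⟨h, hy⟩]⟩
  obtain ⟨h', e⟩ := hdec _ hex
  rw [e, huniq _ h'.choose_spec.1]

open Classical in
/-- The probability that the algorithm has not terminated after `n` slots. -/
noncomputable def Rule.overrunProb (rule : Rule N F) (ch : ErasureChannel N) (K : Fin N → ℕ)
    (n : ℕ) : ℝ :=
  ∑ z : Fin n → Finset (Fin N),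
    if rule.current (rule.state K n z) = none then 0 else ∏ t, ch.prob (z t)

theorem Rule.overrunProb_nonneg (ch : ErasureChannel N) (K : Fin N → ℕ) :
    0 ≤ rule.overrunProb ch K n := by
  refine Finset.sum_nonneg fun z _ => ?_
  split_ifs
  · exact le_rfl
  · exact Finset.prod_nonneg fun t _ => ch.prob_nonneg _

theorem Rule.avgErrorProb_code_le (ch : ErasureChannel N) :
    (rule.code K φ n).avgErrorProb ch ≤ rule.overrunProb ch K n := by
  refine div_le_of_le_mul₀ (by positivity) (rule.overrunProb_nonneg n ch K) ?_
  have : ∀ w, (rule.code K φ n).errorProb ch w ≤ rule.overrunProb ch K n := by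
    intro w
    refine Finset.sum_le_sum fun z _ => ?_
    by_cases h : rule.current (rule.state K n z) = none
    · rw [if_pos h, if_neg]
      push Not
      exact rule.dec_code φ n w h
    · rw [if_neg h]
      split_ifs
      · exact le_rfl
      · exact Finset.prod_nonneg fun t _ => ch.prob_nonneg _
  calc _ ≤ ∑ _w : (i : Fin N) → Fin (M i), rule.overrunProb ch K n :=
        Finset.sum_le_sum fun w _ => this w
    _ = _ := by rw [Finset.sum_const, nsmul_eq_mul, Finset.card_univ, mul_comm]

end Code

end Code1

/-! ### Erasure probabilities and expectations over the erasures -/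

namespace ErasureChannel

variable {N : ℕ} (ch : ErasureChannel N)

theorem eps_nonneg (I : Finset (Fin N)) : 0 ≤ ch.eps I :=
  Finset.sum_nonneg fun Z _ => ch.prob_nonneg Z

theorem eps_anti {I J : Finset (Fin N)} (h : I ⊆ J) : ch.eps J ≤ ch.eps I :=
  Finset.sum_le_sum_of_subset_of_nonneg
    (fun Z hZ => by
      simp only [Finset.mem_filter, Finset.mem_univ, true_and] at hZ ⊢
      exact h.trans hZ) fun Z _ _ => ch.prob_nonneg Z

theorem eps_lt_one {I : Finset (Fin N)} (h : I.Nonempty) : ch.eps I < 1 := by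
  obtain ⟨i, hi⟩ := h
  exact (ch.eps_anti (Finset.singleton_subset_iff.2 hi)).trans_lt (ch.erasure_lt_one i)

theorem one_sub_eps_pos {I : Finset (Fin N)} (h : I.Nonempty) : 0 < 1 - ch.eps I :=
  sub_pos.2 (ch.eps_lt_one h)

theorem eps_univ_sdiff (H : Finset (Fin N)) :
    ch.eps (Finset.univ \ H) = ∑ Z, if Zᶜ ⊆ H then ch.prob Z else 0 := by
  rw [eps, Finset.sum_filter]
  refine Finset.sum_congr rfl fun Z _ => ?_
  have : Finset.univ \ H ⊆ Z ↔ Zᶜ ⊆ H := by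
    rw [← Finset.compl_eq_univ_sdiff, ← Finset.compl_subset_compl, compl_compl]
  simp only [this]

/-- The expectation of a function of the erasures of the first `n` slots. -/
noncomputable def expect (n : ℕ) (f : (Fin n → Finset (Fin N)) → ℝ) : ℝ :=
  ∑ z, (∏ t, ch.prob (z t)) * f z

theorem expect_succ {n : ℕ} (f : (Fin (n + 1) → Finset (Fin N)) → ℝ) :
    ch.expect (n + 1) f =
      ch.expect n fun z => ∑ Z, ch.prob Z * f (Fin.snoc (α := fun _ => Finset (Fin N)) z Z) := by
  unfold expect
  rw [← Fintype.sum_equiv (Fin.snocEquiv fun _ : Fin (n + 1) => Finset (Fin N))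
    (fun p => (∏ t, ch.prob ((Fin.snoc p.2 p.1 : Fin (n + 1) → Finset (Fin N)) t)) *
      f (Fin.snoc (α := fun _ => Finset (Fin N)) p.2 p.1)) _ fun p => rfl,
    Fintype.sum_prod_type_right]
  refine Finset.sum_congr rfl fun z _ => ?_
  rw [Finset.mul_sum]
  refine Finset.sum_congr rfl fun Z _ => ?_
  rw [Fin.prod_univ_castSucc]
  simp only [Fin.snoc_castSucc, Fin.snoc_last]
  ring

theorem expect_mono {n : ℕ} {f g : (Fin n → Finset (Fin N)) → ℝ} (h : ∀ z, f z ≤ g z) :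
    ch.expect n f ≤ ch.expect n g :=
  Finset.sum_le_sum fun z _ =>
    mul_le_mul_of_nonneg_left (h z) (Finset.prod_nonneg fun _ _ => ch.prob_nonneg _)

theorem expect_add {n : ℕ} (f g : (Fin n → Finset (Fin N)) → ℝ) :
    ch.expect n (fun z => f z + g z) = ch.expect n f + ch.expect n g := by
  simp [expect, mul_add, Finset.sum_add_distrib]

theorem expect_const_mul {n : ℕ} (c : ℝ) (f : (Fin n → Finset (Fin N)) → ℝ) :
    ch.expect n (fun z => c * f z) = c * ch.expect n f := by
  simp only [expect, Finset.mul_sum]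
  exact Finset.sum_congr rfl fun z _ => by ring

theorem expect_sum {n : ℕ} {ι : Type*} (s : Finset ι) (f : ι → (Fin n → Finset (Fin N)) → ℝ) :
    ch.expect n (fun z => ∑ j ∈ s, f j z) = ∑ j ∈ s, ch.expect n (f j) := by
  simp only [expect, Finset.mul_sum]
  exact Finset.sum_comm

theorem expect_const {n : ℕ} (c : ℝ) : ch.expect n (fun _ => c) = c := by
  induction n with
  | zero => simp [expect]
  | succ n ih =>
    rw [expect_succ]
    simp only [← Finset.sum_mul, ch.prob_sum, one_mul]
    exact ih

/-- The second moment of a martingale with increments bounded by `C` grows at most linearly. -/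
theorem expect_sq_sub_le {X : (t : ℕ) → (Fin t → Finset (Fin N)) → ℝ} {x C : ℝ}
    (h0 : ∀ z, X 0 z = x)
    (hX : ∀ t z, ∑ Z, ch.prob Z * X (t + 1) (Fin.snoc (α := fun _ => Finset (Fin N)) z Z) = X t z)
    (hC : ∀ t z Z, |X (t + 1) (Fin.snoc (α := fun _ => Finset (Fin N)) z Z) - X t z| ≤ C)
    (n : ℕ) : ch.expect n (fun z => (X n z - x) ^ 2) ≤ n * C ^ 2 := by
  induction n with
  | zero => simp [expect, h0]
  | succ n ih =>
    rw [expect_succ]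
    calc _ ≤ ch.expect n fun z => (X n z - x) ^ 2 + C ^ 2 := by
          refine ch.expect_mono fun z => ?_
          have hd : ∀ Z, ch.prob Z *
                (X (n + 1) (Fin.snoc (α := fun _ => Finset (Fin N)) z Z) - x) ^ 2
              ≤ ch.prob Z * ((X n z - x) ^ 2 + C ^ 2 - 2 * (X n z - x) * X n z) +
                2 * (X n z - x) *
                  (ch.prob Z * X (n + 1) (Fin.snoc (α := fun _ => Finset (Fin N)) z Z)) := by
            intro Z
            have := sq_le_sq' (neg_le_of_abs_le (hC n z Z)) (le_of_abs_le (hC n z Z))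
            nlinarith [mul_le_mul_of_nonneg_left this (ch.prob_nonneg Z)]
          refine (Finset.sum_le_sum fun Z _ => hd Z).trans (le_of_eq ?_)
          rw [Finset.sum_add_distrib, ← Finset.sum_mul, ← Finset.mul_sum, hX, ch.prob_sum]
          ring
      _ ≤ _ := by
          rw [expect_add, expect_const]
          push_cast
          linarith

open Classical in
/-- Chebyshev's inequality for a martingale with increments bounded by `C`. -/
theorem expect_ite_le {X : (t : ℕ) → (Fin t → Finset (Fin N)) → ℝ} {x C : ℝ}
    (h0 : ∀ z, X 0 z = x)
    (hX : ∀ t z, ∑ Z, ch.prob Z * X (t + 1) (Fin.snoc (α := fun _ => Finset (Fin N)) z Z) = X t z)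
    (hC : ∀ t z Z, |X (t + 1) (Fin.snoc (α := fun _ => Finset (Fin N)) z Z) - X t z| ≤ C)
    (n : ℕ) {a : ℝ} (ha : 0 < a) :
    ch.expect n (fun z => if x + a ≤ X n z then 1 else 0) ≤ C ^ 2 * (n / a ^ 2) := by
  have h := ch.expect_sq_sub_le h0 hX hC n
  have hle : ch.expect n (fun z => a ^ 2 * if x + a ≤ X n z then 1 else 0) ≤
      ch.expect n (fun z => (X n z - x) ^ 2) := by
    refine ch.expect_mono fun z => ?_
    split_ifs with hz
    · rw [mul_one]; exact pow_le_pow_left₀ ha.le (by linarith) 2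
    · rw [mul_zero]; positivity
  rw [expect_const_mul] at hle
  have hpos : 0 < a ^ 2 := by positivity
  rw [← mul_div_assoc, le_div_iff₀ hpos]
  linarith

/-! ### The expected number of slots that a token spends in a queue -/

/-- The expected number of slots that a token of user `i` which is in `Q_T` will spend in `Q_S`
while these queues are processed. The token moves from `Q_T` to `Q_{T ∪ G}` until user `i` is
among the users `G` that receive the packet, and inclusion-exclusion gives the probability
that it is in `Q_S` after a given number of slots. -/
noncomputable def visits (i : Fin N) (S T : Finset (Fin N)) : ℝ :=
  ∑ H ∈ (S.erase i).powerset with T.erase i ⊆ H,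
    (-1) ^ (S.card - H.card - 1) / (1 - ch.eps (Finset.univ \ H))

theorem visits_singleton (i : Fin N) (S : Finset (Fin N)) : ch.visits i S {i} = ch.fhat S i := by
  simp [visits, fhat]

/-- Alternating sum over the sets between `T \ {i}` and `S \ {i}`. -/
theorem sum_neg_one_pow_card_sub {i : Fin N} {S T : Finset (Fin N)} (hS : i ∈ S) (hT : i ∈ T) :
    ∑ H ∈ (S.erase i).powerset with T.erase i ⊆ H, (-1 : ℝ) ^ (S.card - H.card - 1) =
      if T = S then 1 else 0 := by
  have hIcc : (S.erase i).powerset.filter (fun H => T.erase i ⊆ H) =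
      Finset.Icc (T.erase i) (S.erase i) := by
    ext H; simp [Finset.mem_Icc, and_comm]
  rw [hIcc]
  by_cases hsub : T ⊆ S
  · rw [Finset.Icc_eq_image_powerset (Finset.erase_subset_erase i hsub), Finset.sum_image]
    · have hsd : S.erase i \ T.erase i = S \ T := by
        ext j; simp only [Finset.mem_sdiff, Finset.mem_erase]
        constructor
        · rintro ⟨⟨h1, h2⟩, h3⟩; exact ⟨h2, fun h => h3 ⟨h1, h⟩⟩
        · rintro ⟨h1, h2⟩
          exact ⟨⟨fun h => h2 (h ▸ hT), h1⟩, fun h => h2 h.2⟩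
      rw [hsd]
      have hsign : ∀ H' ∈ (S \ T).powerset,
          (-1 : ℝ) ^ (S.card - (T.erase i ∪ H').card - 1) =
            (-1) ^ (S \ T).card * (-1) ^ H'.card := by
        intro H' hH'
        rw [Finset.mem_powerset] at hH'
        have hdisj : Disjoint (T.erase i) H' :=
          (Finset.disjoint_sdiff.mono_right hH').mono_left (Finset.erase_subset i T)
        rw [Finset.card_union_of_disjoint hdisj, Finset.card_erase_of_mem hT]
        have h1 := Finset.card_le_card hH'
        have h2 := Finset.card_sdiff_of_subset hsub
        have h3 := Finset.card_le_card hsub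
        have h4 : 0 < T.card := Finset.card_pos.2 ⟨i, hT⟩
        have e1 : S.card - (T.card - 1 + H'.card) - 1 = (S \ T).card - H'.card := by omega
        rw [e1, ← pow_add]
        have e2 : (S \ T).card + H'.card = ((S \ T).card - H'.card) + 2 * H'.card := by omega
        rw [e2, pow_add, pow_mul]
        simp
      rw [Finset.sum_congr rfl hsign, ← Finset.mul_sum]
      have := congrArg (Int.cast : ℤ → ℝ) (Finset.sum_powerset_neg_one_pow_card (x := S \ T))
      push_cast at this
      rw [this]
      by_cases hST : T = S
      · subst hST; simp
      · rw [if_neg hST, if_neg, mul_zero]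
        intro h
        exact hST (hsub.antisymm (Finset.sdiff_eq_empty_iff_subset.1 h))
    · intro A hA B hB hAB
      rw [Finset.mem_coe, Finset.mem_powerset] at hA hB
      have hA' : Disjoint (T.erase i) A := Finset.disjoint_sdiff.mono_right hA
      have hB' : Disjoint (T.erase i) B := Finset.disjoint_sdiff.mono_right hB
      simp only at hAB
      rw [← Finset.union_sdiff_cancel_left hA', hAB, Finset.union_sdiff_cancel_left hB']
  · rw [Finset.Icc_eq_empty, Finset.sum_empty, if_neg]
    · rintro rfl; exact hsub subset_rfl
    · intro h
      apply hsub
      rw [← Finset.insert_erase hT, ← Finset.insert_erase hS]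
      exact Finset.insert_subset_insert i h

/-- The first step of the walk of a token that is in `Q_T`. -/
theorem sum_prob_mul_visits {i : Fin N} {S T : Finset (Fin N)} (hS : i ∈ S) (hT : i ∈ T) :
    ∑ Z, ch.prob Z * (if i ∈ Z then ch.visits i S (T ∪ Zᶜ) else 0) =
      ch.visits i S T - if T = S then 1 else 0 := by
  have h1 : ∀ Z, ch.prob Z * (if i ∈ Z then ch.visits i S (T ∪ Zᶜ) else 0) =
      ∑ H ∈ (S.erase i).powerset with T.erase i ⊆ H,
        (if Zᶜ ⊆ H then ch.prob Z else 0) *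
          ((-1) ^ (S.card - H.card - 1) / (1 - ch.eps (Finset.univ \ H))) := by
    intro Z
    by_cases hi : i ∈ Z
    · rw [if_pos hi, visits, Finset.mul_sum, Finset.sum_filter, Finset.sum_filter]
      refine Finset.sum_congr rfl fun H _ => ?_
      have : (T ∪ Zᶜ).erase i ⊆ H ↔ T.erase i ⊆ H ∧ Zᶜ ⊆ H := by
        rw [Finset.erase_union_distrib, Finset.union_subset_iff,
          Finset.erase_eq_of_notMem (a := i) (s := Zᶜ) (by simpa using hi)]
      simp only [this]
      by_cases h1 : T.erase i ⊆ H <;> by_cases h2 : Zᶜ ⊆ H <;> simp [h1, h2]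
    · rw [if_neg hi, mul_zero]
      refine (Finset.sum_eq_zero fun H hH => ?_).symm
      rw [if_neg, zero_mul]
      intro h
      rw [Finset.mem_filter, Finset.mem_powerset] at hH
      exact Finset.notMem_erase i S (hH.1 (h (by simpa using hi)))
  rw [Finset.sum_congr rfl fun Z _ => h1 Z, Finset.sum_comm, visits,
    ← sum_neg_one_pow_card_sub hS hT, ← Finset.sum_sub_distrib]
  refine Finset.sum_congr rfl fun H hH => ?_
  rw [← Finset.sum_mul, ← eps_univ_sdiff]
  have hne : 1 - ch.eps (Finset.univ \ H) ≠ 0 := by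
    refine (ch.one_sub_eps_pos ⟨i, ?_⟩).ne'
    rw [Finset.mem_filter, Finset.mem_powerset] at hH
    simpa using fun h => Finset.notMem_erase i S (hH.1 h)
  field_simp
  ring

/-- By induction from the larger sets `T`, using the first step of the walk. -/
theorem visits_nonneg {i : Fin N} {S : Finset (Fin N)} (hS : i ∈ S) {T : Finset (Fin N)}
    (hT : i ∈ T) : 0 ≤ ch.visits i S T := by
  induction hn : (Tᶜ).card using Nat.strong_induction_on generalizing T with
  | _ n ih =>
    have h := ch.sum_prob_mul_visits hS hT
    have hle : ∑ Z, ch.prob Z * (if i ∈ Z ∧ Zᶜ ⊆ T then ch.visits i S T else 0) ≤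
        ∑ Z, ch.prob Z * (if i ∈ Z then ch.visits i S (T ∪ Zᶜ) else 0) := by
      refine Finset.sum_le_sum fun Z _ => mul_le_mul_of_nonneg_left ?_ (ch.prob_nonneg Z)
      by_cases hi : i ∈ Z
      · by_cases hZ : Zᶜ ⊆ T
        · simp [hi, hZ, Finset.union_eq_left.2 hZ]
        · simp only [hi, hZ, and_false, if_false, if_true]
          refine ih _ ?_ (Finset.mem_union_left _ hT) rfl
          rw [← hn]
          refine Finset.card_lt_card (Finset.compl_ssubset_compl.2 ?_)
          exact left_lt_sup.2 hZ
      · simp [hi]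
    have hp : ∑ Z, ch.prob Z * (if i ∈ Z ∧ Zᶜ ⊆ T then ch.visits i S T else 0) =
        (∑ Z, if i ∈ Z ∧ Zᶜ ⊆ T then ch.prob Z else 0) * ch.visits i S T := by
      rw [Finset.sum_mul]
      exact Finset.sum_congr rfl fun Z _ => by split_ifs <;> simp
    have hlt : (∑ Z, if i ∈ Z ∧ Zᶜ ⊆ T then ch.prob Z else 0) < 1 := by
      refine lt_of_le_of_lt ?_ (ch.erasure_lt_one i)
      rw [Finset.sum_filter]
      refine Finset.sum_le_sum fun Z _ => ?_
      by_cases hi : i ∈ Z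
      · by_cases hZ : Zᶜ ⊆ T <;> simp [hi, hZ, ch.prob_nonneg]
      · simp [hi]
    rw [h, hp] at hle
    have h01 : (0 : ℝ) ≤ if T = S then 1 else 0 := by split_ifs <;> norm_num
    by_contra hneg
    push Not at hneg
    nlinarith

theorem fhat_nonneg {i : Fin N} {S : Finset (Fin N)} (hS : i ∈ S) : 0 ≤ ch.fhat S i := by
  rw [← visits_singleton]
  exact ch.visits_nonneg hS (Finset.mem_singleton_self i)

end ErasureChannel

/-! ### The duration of the algorithm -/

namespace Code1

section Potential

variable {N : ℕ} {F : Type*} {K : Fin N → ℕ}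

/-- The expected number of slots that the tokens of user `i` still spend in `Q_S`. -/
noncomputable def State.potential (ch : ErasureChannel N) (st : State F K) (i : Fin N)
    (S : Finset (Fin N)) : ℝ :=
  ∑ T with i ∈ T, st.idx T i * ch.visits i S T

theorem State.potential_nonneg (ch : ErasureChannel N) (st : State F K) {i : Fin N}
    {S : Finset (Fin N)} (hi : i ∈ S) : 0 ≤ st.potential ch i S :=
  Finset.sum_nonneg fun T hT => mul_nonneg (Nat.cast_nonneg _)
    (ch.visits_nonneg hi (by simpa using hT))

variable [Field F]

theorem State.potential_update_of_not_mem (ch : ErasureChannel N) (st : State F K) {i : Fin N}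
    (S : Finset (Fin N)) {Q : Finset (Fin N)} (h : ¬ (i ∈ Q ∧ 0 < st.idx Q i))
    (d : Choice F K) (G : Finset (Fin N)) :
    (st.update Q d G).potential ch i S = st.potential ch i S := by
  have hg : ¬ st.Gains Q G i := fun h' => h ⟨h'.1, h'.2.2⟩
  have hs : ¬ st.Shifts Q G i := fun h' => h ⟨h'.2.1, h'.2.2.2⟩
  simp [State.potential, State.update, hg, hs]

theorem State.potential_update (ch : ErasureChannel N) (st : State F K) {i : Fin N}
    (S : Finset (Fin N)) {Q : Finset (Fin N)} (hi : i ∈ Q) (h0 : 0 < st.idx Q i)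
    (d : Choice F K) (Z : Finset (Fin N)) :
    (st.update Q d Zᶜ).potential ch i S = st.potential ch i S - ch.visits i S Q +
      if i ∈ Z then ch.visits i S (Q ∪ Zᶜ) else 0 := by
  have hsum : ∀ (U : Finset (Fin N)), i ∈ U →
      ∑ T with i ∈ T, (if T = U then ch.visits i S T else 0) = ch.visits i S U := by
    intro U hU
    rw [Finset.sum_filter, Finset.sum_eq_single U]
    · simp [hU]
    · intro T _ hT; simp [hT]
    · simp
  by_cases hiZ : i ∈ Z
  · have hg : ¬ st.Gains Q Zᶜ i := fun h => by simpa [hiZ] using h.2.1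
    rw [if_pos hiZ]
    by_cases hsub : Zᶜ ⊆ Q
    · have hs : ¬ st.Shifts Q Zᶜ i := fun h => by
        obtain ⟨j, hj, hjQ⟩ := h.1.2
        exact hjQ (hsub hj)
      rw [Finset.union_eq_left.2 hsub]
      simp [State.potential, State.update, hg, hs]
    · have hs : st.Shifts Q Zᶜ i := by
        refine ⟨⟨⟨i, hi, by simpa using hiZ⟩, ?_⟩, hi, by simpa using hiZ, h0⟩
        simpa [Finset.subset_iff] using hsub
      have hne : Q ∪ Zᶜ ≠ Q := fun h => hsub (Finset.union_eq_left.1 h)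
      rw [← hsum Q hi, ← hsum (Q ∪ Zᶜ) (Finset.mem_union_left _ hi), State.potential,
        State.potential, ← Finset.sum_sub_distrib, ← Finset.sum_add_distrib]
      refine Finset.sum_congr rfl fun T _ => ?_
      simp only [State.update, hs, or_true, and_true]
      by_cases hT : T = Q
      · subst hT
        rw [if_pos rfl, if_pos rfl, if_neg hne.symm, Nat.cast_sub h0]
        push_cast; ring
      · by_cases hT' : T = Q ∪ Zᶜ
        · rw [if_neg hT, if_neg hT, if_pos hT', if_pos hT']
          push_cast; ring
        · rw [if_neg hT, if_neg hT, if_neg hT', if_neg hT']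
          ring
  · have hg : st.Gains Q Zᶜ i := ⟨hi, by simpa using hiZ, h0⟩
    have hs : ¬ st.Shifts Q Zᶜ i := fun h => h.2.2.1 hg.2.1
    rw [if_neg hiZ, add_zero, ← hsum Q hi, State.potential,
      State.potential, ← Finset.sum_sub_distrib]
    refine Finset.sum_congr rfl fun T _ => ?_
    simp only [State.update, hs, hg, true_or, and_true, and_false, if_false]
    by_cases hT : T = Q
    · subst hT
      rw [if_pos rfl, if_pos rfl, Nat.cast_sub h0]
      push_cast; ring
    · rw [if_neg hT, if_neg hT]
      ring

end Potential

variable {N : ℕ} {F : Type*} [Field F] {K : Fin N → ℕ} (rule : Rule N F)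

open Classical in
/-- The number of slots, among the first `t`, in which the queue `Q_S` is processed. -/
noncomputable def Rule.served (rule : Rule N F) (K : Fin N → ℕ) (S : Finset (Fin N)) :
    (t : ℕ) → (Fin t → Finset (Fin N)) → ℕ
  | 0, _ => 0
  | t + 1, z => rule.served K S t (fun s => z s.castSucc) +
      if rule.current (rule.state K t fun s => z s.castSucc) = some S then 1 else 0

open Classical in
/-- The number of slots, among the first `t`, in which the queue `Q_S` is processed and user `i`
still expects tokens from it. -/
noncomputable def Rule.busy (rule : Rule N F) (K : Fin N → ℕ) (i : Fin N) (S : Finset (Fin N)) :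
    (t : ℕ) → (Fin t → Finset (Fin N)) → ℕ
  | 0, _ => 0
  | t + 1, z => rule.busy K i S t (fun s => z s.castSucc) +
      if rule.current (rule.state K t fun s => z s.castSucc) = some S ∧
        0 < (rule.state K t fun s => z s.castSucc).idx S i then 1 else 0

theorem Rule.state_snoc {t : ℕ} (z : Fin t → Finset (Fin N)) (Z : Finset (Fin N)) :
    rule.state K (t + 1) (Fin.snoc (α := fun _ => Finset (Fin N)) z Z) =
      match rule.current (rule.state K t z) with
      | none => rule.state K t z
      | some S => (rule.state K t z).update S (rule.choice z (rule.state K t z) S) Zᶜ := by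
  rw [Rule.state]
  simp only [Fin.snoc_castSucc, Fin.snoc_last]

/-- The slots that user `i` has spent in `Q_S`, together with those that are still expected. -/
noncomputable def Rule.forecast (rule : Rule N F) (ch : ErasureChannel N) (K : Fin N → ℕ)
    (i : Fin N) (S : Finset (Fin N)) (t : ℕ) (z : Fin t → Finset (Fin N)) : ℝ :=
  (rule.state K t z).potential ch i S + rule.busy K i S t z

theorem Rule.forecast_zero (ch : ErasureChannel N) (i : Fin N) (S : Finset (Fin N))
    (z : Fin 0 → Finset (Fin N)) : rule.forecast ch K i S 0 z = K i * ch.fhat S i := by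
  rw [Rule.forecast, Rule.busy, Rule.state, State.potential, Finset.sum_eq_single {i}]
  · simp [initState, ch.visits_singleton]
  · intro T _ hT; simp [initState, hT]
  · simp

/-- In one slot the forecast changes by the deviation of one token from its expected walk. -/
theorem Rule.forecast_snoc (ch : ErasureChannel N) {i : Fin N} {S : Finset (Fin N)} (hi : i ∈ S)
    {t : ℕ} (z : Fin t → Finset (Fin N)) :
    (∀ Z, rule.forecast ch K i S (t + 1) (Fin.snoc (α := fun _ => Finset (Fin N)) z Z) =
      rule.forecast ch K i S t z) ∨
    ∃ Q, i ∈ Q ∧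
      ∀ Z, rule.forecast ch K i S (t + 1) (Fin.snoc (α := fun _ => Finset (Fin N)) z Z) =
        rule.forecast ch K i S t z + (if Q = S then 1 else 0) - ch.visits i S Q +
          if i ∈ Z then ch.visits i S (Q ∪ Zᶜ) else 0 := by
  have hbusy : ∀ Z, rule.forecast ch K i S (t + 1) (Fin.snoc (α := fun _ => Finset (Fin N)) z Z) =
      (rule.state K (t + 1) (Fin.snoc (α := fun _ => Finset (Fin N)) z Z)).potential ch i S +
      (rule.busy K i S t z + if rule.current (rule.state K t z) = some S ∧
        0 < (rule.state K t z).idx S i then 1 else 0) := by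
    intro Z
    rw [Rule.forecast, Rule.busy]
    simp only [Fin.snoc_castSucc]
    push_cast
    rfl
  cases hcur : rule.current (rule.state K t z) with
  | none =>
    refine Or.inl fun Z => ?_
    rw [hbusy, rule.state_snoc, hcur]
    simp [Rule.forecast]
  | some Q =>
    by_cases h : i ∈ Q ∧ 0 < (rule.state K t z).idx Q i
    · refine Or.inr ⟨Q, h.1, fun Z => ?_⟩
      rw [hbusy, rule.state_snoc, hcur]
      simp only
      rw [State.potential_update ch _ S h.1 h.2, Rule.forecast]
      by_cases hQ : Q = S
      · subst hQ
        simp only [h.2, and_self, if_true]; ring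
      · simp only [Option.some.injEq, hQ, false_and, if_false]; ring
    · refine Or.inl fun Z => ?_
      rw [hbusy, rule.state_snoc, hcur]
      simp only
      rw [State.potential_update_of_not_mem ch _ S h, Rule.forecast, if_neg, add_zero]
      rintro ⟨h1, h2⟩
      obtain rfl := Option.some.inj h1
      exact h ⟨hi, h2⟩

/-- The forecast is a martingale. -/
theorem Rule.sum_prob_mul_forecast (ch : ErasureChannel N) {i : Fin N} {S : Finset (Fin N)}
    (hi : i ∈ S) {t : ℕ} (z : Fin t → Finset (Fin N)) :
    ∑ Z, ch.prob Z *
      rule.forecast ch K i S (t + 1) (Fin.snoc (α := fun _ => Finset (Fin N)) z Z) =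
        rule.forecast ch K i S t z := by
  rcases rule.forecast_snoc (K := K) ch hi z with h | ⟨Q, hQ, h⟩
  · simp only [h, ← Finset.sum_mul, ch.prob_sum, one_mul]
  · simp only [h, mul_add, Finset.sum_add_distrib, ← Finset.sum_mul, ch.prob_sum, one_mul, mul_sub,
      Finset.sum_sub_distrib, ch.sum_prob_mul_visits hi hQ]
    ring

/-- A bound on the change of the forecast in one slot. -/
noncomputable def incrementBound (ch : ErasureChannel N) (i : Fin N) (S : Finset (Fin N)) : ℝ :=
  1 + 2 * ∑ T, |ch.visits i S T|

theorem Rule.abs_forecast_sub_le (ch : ErasureChannel N) {i : Fin N} {S : Finset (Fin N)}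
    (hi : i ∈ S) {t : ℕ} (z : Fin t → Finset (Fin N)) (Z : Finset (Fin N)) :
    |rule.forecast ch K i S (t + 1) (Fin.snoc (α := fun _ => Finset (Fin N)) z Z) -
      rule.forecast ch K i S t z| ≤ incrementBound ch i S := by
  have hV : ∀ U, |ch.visits i S U| ≤ ∑ T, |ch.visits i S T| := fun U =>
    Finset.single_le_sum (f := fun T => |ch.visits i S T|) (fun T _ => abs_nonneg _)
      (Finset.mem_univ U)
  have hV0 : 0 ≤ ∑ T, |ch.visits i S T| := Finset.sum_nonneg fun T _ => abs_nonneg _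
  unfold incrementBound
  rcases rule.forecast_snoc (K := K) ch hi z with h | ⟨Q, hQ, h⟩
  · rw [h, sub_self, abs_zero]; linarith
  · rw [h]
    have h1 := abs_le.1 (hV Q)
    have h2 := abs_le.1 (hV (Q ∪ Zᶜ))
    rw [abs_le]
    split_ifs <;> constructor <;> linarith

/-- Queues are finished level by level: a queue that has been served is never joined by new
tokens, and therefore every user who still expects tokens from it was busy all the time. -/
theorem Rule.served_invariant {t : ℕ} (z : Fin t → Finset (Fin N)) (S : Finset (Fin N)) :
    (∀ i ∈ S, 0 < (rule.state K t z).idx S i → rule.busy K i S t z = rule.served K S t z) ∧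
    (0 < rule.served K S t z → ∃ i ∈ S, rule.busy K i S t z = rule.served K S t z) ∧
    (0 < rule.served K S t z → ∀ T, T.card < S.card → ¬ (rule.state K t z).Active T) ∧
    (∀ i, rule.busy K i S t z ≤ rule.served K S t z) := by
  classical
  induction t with
  | zero => simp [Rule.served, Rule.busy]
  | succ t ih =>
    obtain ⟨h1, h2, h3, h4⟩ := ih fun s => z s.castSucc
    rw [Rule.served, Rule.state]
    simp only [Rule.busy]
    set st := rule.state K t fun s => z s.castSucc with hst
    cases hcur : rule.current st with
    | none => simpa [hcur] using ⟨h1, h2, h3, h4⟩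
    | some Q =>
      have hQ := rule.active_of_current hcur
      -- an index that grows belongs to a queue of a higher level than `Q`
      have hgrow : ∀ T i, st.idx T i < (st.update Q (rule.choice (fun s => z s.castSucc) st Q)
          (z (Fin.last t))ᶜ).idx T i → Q.card < T.card := by
        intro T i h
        simp only [State.update] at h
        split_ifs at h with ha hb
        · omega
        · rw [hb.1]
          refine Finset.card_lt_card (left_lt_sup.2 fun hsub => ?_)
          obtain ⟨j, hj, hjQ⟩ := hb.2.1.2
          exact hjQ (hsub hj)
        · omega
      have hact : ∀ T, T.card ≤ Q.card → ¬ st.Active T →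
          ¬ (st.update Q (rule.choice (fun s => z s.castSucc) st Q)
            (z (Fin.last t))ᶜ).Active T := by
        rintro T hT hn ⟨i, hi, h0⟩
        refine hn ⟨i, hi, ?_⟩
        by_contra h
        have := hgrow T i (by omega)
        omega
      have hlow : ∀ T, T.card < Q.card → ¬ st.Active T := by
        intro T hT hTact
        obtain ⟨hQt, as, bs, has, hpre⟩ := List.find?_eq_some_iff_append.1 hcur
        have hTmem : T ∈ rule.order := (rule.mem_order T).2 ⟨_, hTact.choose_spec.1⟩
        have hlev := rule.order_level
        rw [has] at hTmem hlev
        rcases List.mem_append.1 hTmem with hT' | hT'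
        · simpa [hTact] using hpre T hT'
        · rcases List.mem_cons.1 hT' with rfl | hT''
          · omega
          · have := (List.pairwise_cons.1 (List.pairwise_append.1 hlev).2.1).1 T hT''
            omega
      have hQcard : 0 < rule.served K S t (fun s => z s.castSucc) → S.card ≤ Q.card := by
        intro h
        by_contra hlt
        exact h3 h Q (by omega) hQ
      simp only [Option.some.injEq]
      by_cases hQS : Q = S
      · subst hQS
        simp only [true_and, if_true]
        refine ⟨?_, ?_, fun _ T hT => hact T hT.le (hlow T hT), ?_⟩
        · intro i hi h0
          have h0' : 0 < st.idx Q i := by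
            by_contra h
            have := hgrow Q i (by omega)
            omega
          rw [if_pos h0', h1 i hi h0']
        · intro _
          obtain ⟨i, hi, h0⟩ := hQ
          exact ⟨i, hi, by rw [if_pos h0, h1 i hi h0]⟩
        · intro i
          have := h4 i
          split_ifs <;> omega
      · simp only [hQS, false_and, if_false, add_zero]
        refine ⟨?_, h2, fun h T hT => hact T ?_ (h3 h T hT), h4⟩
        · intro i hi h0
          rcases Nat.eq_zero_or_pos (rule.served K S t fun s => z s.castSucc) with hs | hs
          · have := h4 i
            omega
          · refine h1 i hi ?_
            by_contra h
            have := hgrow S i (by omega)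
            have := hQcard hs
            omega
        · have := hQcard h
          omega

/-- Before termination every slot serves exactly one queue. -/
theorem Rule.sum_served {t : ℕ} (z : Fin t → Finset (Fin N))
    (h : rule.current (rule.state K t z) ≠ none) :
    ∑ S with S.Nonempty, rule.served K S t z = t := by
  classical
  induction t with
  | zero => simp [Rule.served]
  | succ t ih =>
    rw [Rule.state] at h
    cases hcur : rule.current (rule.state K t fun s => z s.castSucc) with
    | none => simp [hcur] at h
    | some Q =>
      have hQ : Q.Nonempty := ⟨_, (rule.active_of_current hcur).choose_spec.1⟩
      simp only [Rule.served, Finset.sum_add_distrib]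
      rw [ih _ (by simp [hcur]), hcur, Finset.sum_filter, Finset.sum_eq_single Q]
      · simp [hQ]
      · intro S _ hS; simp [Ne.symm hS]
      · simp

/-- The algorithm terminates in time unless some user is busy for longer than expected: by
`a` slots in one of the queues. -/
theorem Rule.overrunProb_le (ch : ErasureChannel N) (n : ℕ) {a : ℝ} (ha : 0 < a)
    (m : Finset (Fin N) → ℝ) (hm : ∀ S, ∀ i ∈ S, K i * ch.fhat S i + a ≤ m S)
    (hn : ∑ S with S.Nonempty, m S < n) :
    rule.overrunProb ch K n ≤
      (∑ S, ∑ i ∈ S, incrementBound ch i S ^ 2) * (n / a ^ 2) := by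
  classical
  have hle : rule.overrunProb ch K n ≤ ch.expect n fun z =>
      ∑ S : Finset (Fin N), ∑ i ∈ S,
        if K i * ch.fhat S i + a ≤ rule.forecast ch K i S n z then 1 else 0 := by
    refine Finset.sum_le_sum fun z _ => ?_
    have hnonneg : ∀ S : Finset (Fin N), ∀ i ∈ S, (0 : ℝ) ≤
        if K i * ch.fhat S i + a ≤ rule.forecast ch K i S n z then 1 else 0 := by
      intro S i _; split_ifs <;> norm_num
    have hprod : 0 ≤ ∏ t, ch.prob (z t) := Finset.prod_nonneg fun t _ => ch.prob_nonneg _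
    split_ifs with hcur
    · exact mul_nonneg hprod
        (Finset.sum_nonneg fun S _ => Finset.sum_nonneg (hnonneg S))
    · refine le_mul_of_one_le_right hprod ?_
      by_contra hlt
      have hsmall : ∀ S : Finset (Fin N), ∀ i ∈ S,
          rule.forecast ch K i S n z < K i * ch.fhat S i + a := by
        intro S i hi
        by_contra hbig
        apply hlt
        calc (1 : ℝ) = if K i * ch.fhat S i + a ≤ rule.forecast ch K i S n z then 1 else 0 := by
              rw [if_pos (not_lt.1 hbig)]
          _ ≤ ∑ i ∈ S, if K i * ch.fhat S i + a ≤ rule.forecast ch K i S n z then 1 else 0 :=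
              Finset.single_le_sum (f := fun i =>
                if K i * ch.fhat S i + a ≤ rule.forecast ch K i S n z then (1 : ℝ) else 0)
                (hnonneg S) hi
          _ ≤ _ := Finset.single_le_sum (f := fun S : Finset (Fin N) => ∑ i ∈ S,
                if K i * ch.fhat S i + a ≤ rule.forecast ch K i S n z then (1 : ℝ) else 0)
                (fun S _ => Finset.sum_nonneg (hnonneg S)) (Finset.mem_univ S)
      have hserved : ∀ S : Finset (Fin N), S.Nonempty → (rule.served K S n z : ℝ) ≤ m S := by
        rintro S ⟨j, hj⟩
        obtain ⟨-, h2, -, -⟩ := rule.served_invariant (K := K) z S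
        rcases Nat.eq_zero_or_pos (rule.served K S n z) with h0 | h0
        · rw [h0, Nat.cast_zero]
          refine le_trans ?_ (hm S j hj)
          exact add_nonneg (mul_nonneg (Nat.cast_nonneg _) (ch.fhat_nonneg hj)) ha.le
        · obtain ⟨i, hi, hb⟩ := h2 h0
          have h3 := hsmall S i hi
          have h4 := (rule.state K n z).potential_nonneg ch hi
          rw [Rule.forecast, hb] at h3
          linarith [hm S i hi]
      have hsum := rule.sum_served z hcur
      have : (n : ℝ) ≤ ∑ S with S.Nonempty, m S := by
        conv_lhs => rw [← hsum]
        push_cast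
        exact Finset.sum_le_sum fun S hS => hserved S (by simpa using hS)
      linarith
  refine hle.trans ?_
  rw [ch.expect_sum, Finset.sum_mul]
  refine Finset.sum_le_sum fun S _ => ?_
  rw [ch.expect_sum, Finset.sum_mul]
  refine Finset.sum_le_sum fun i hi => ?_
  exact ch.expect_ite_le (X := rule.forecast ch K i S) (rule.forecast_zero ch i S)
    (fun t z => rule.sum_prob_mul_forecast ch hi z)
    (fun t z Z => rule.abs_forecast_sub_le ch hi z Z) n ha

end Code1

/-! ### Achievability of ordered rates -/

namespace ErasureChannel

variable {N : ℕ} (ch : ErasureChannel N)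

theorem sum_Icc_neg_one_pow_card_sub {α : Type*} [DecidableEq α] {H A : Finset α} (h : H ⊆ A) :
    ∑ B ∈ Finset.Icc H A, (-1 : ℝ) ^ (B.card - H.card) = if H = A then 1 else 0 := by
  rw [Finset.Icc_eq_image_powerset h, Finset.sum_image]
  · have hterm : ∀ B ∈ (A \ H).powerset, (-1 : ℝ) ^ ((H ∪ B).card - H.card) = (-1) ^ B.card := by
      intro B hB
      rw [Finset.mem_powerset] at hB
      rw [Finset.card_union_of_disjoint (Finset.disjoint_sdiff.mono_right hB),
        Nat.add_sub_cancel_left]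
    rw [Finset.sum_congr rfl hterm]
    have := congrArg (Int.cast : ℤ → ℝ) (Finset.sum_powerset_neg_one_pow_card (x := A \ H))
    push_cast at this
    rw [this]
    have : A \ H = ∅ ↔ H = A :=
      ⟨fun h' => h.antisymm (Finset.sdiff_eq_empty_iff_subset.1 h'), fun h' => by simp [h']⟩
    simp only [this]
  · intro B hB C hC hBC
    rw [Finset.mem_coe, Finset.mem_powerset] at hB hC
    simp only at hBC
    rw [← Finset.union_sdiff_cancel_left (Finset.disjoint_sdiff.mono_right hB), hBC,
      Finset.union_sdiff_cancel_left (Finset.disjoint_sdiff.mono_right hC)]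

/-- Möbius inversion: the slots that a token of user `i` spends in the queues `Q_S` with
`S ⊆ A ∪ {i}` are those before a user outside `A` receives the packet. -/
theorem sum_fhat_insert {i : Fin N} {A : Finset (Fin N)} (hi : i ∉ A) :
    ∑ B ∈ A.powerset, ch.fhat (insert i B) i = 1 / (1 - ch.eps (Finset.univ \ A)) := by
  have h1 : ∀ B ∈ A.powerset, ch.fhat (insert i B) i =
      ∑ H ∈ B.powerset, (-1 : ℝ) ^ (B.card - H.card) / (1 - ch.eps (Finset.univ \ H)) := by
    intro B hB
    have hiB : i ∉ B := fun h => hi (Finset.mem_powerset.1 hB h)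
    rw [fhat, Finset.erase_insert hiB, Finset.card_insert_of_notMem hiB]
    refine Finset.sum_congr rfl fun H _ => ?_
    rw [show B.card + 1 - H.card - 1 = B.card - H.card by omega]
  rw [Finset.sum_congr rfl h1, Finset.sum_comm' (t' := A.powerset) (s' := fun H => Finset.Icc H A)]
  · simp only [← Finset.sum_div]
    rw [Finset.sum_congr rfl fun H hH => by
      rw [sum_Icc_neg_one_pow_card_sub (Finset.mem_powerset.1 hH)]]
    rw [Finset.sum_eq_single A]
    · simp
    · intro H _ hH; simp [hH]
    · simp
  · intro B H
    simp only [Finset.mem_powerset, Finset.mem_Icc]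
    exact ⟨fun h => ⟨⟨h.2, h.1⟩, h.2.trans h.1⟩, fun h => ⟨h.1.2, h.1.1⟩⟩

/-- The value of `f̂^i_S R_i` at the user of `S` that minimizes `π`. -/
noncomputable def leading (π : Equiv.Perm (Fin N)) (R : Fin N → ℝ) (S : Finset (Fin N)) : ℝ :=
  ∑ i ∈ S, if ∀ j ∈ S, π i ≤ π j then ch.fhat S i * R i else 0

theorem fhat_mul_le_leading {π : Equiv.Perm (Fin N)} {R : Fin N → ℝ} (hR : 0 ≤ R)
    (hπ : ∀ S : Finset (Fin N), ∀ i ∈ S,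
      (∀ j ∈ S, π i ≤ π j) → ∀ j ∈ S, ch.fhat S j * R j ≤ ch.fhat S i * R i)
    {S : Finset (Fin N)} {j : Fin N} (hj : j ∈ S) : ch.fhat S j * R j ≤ ch.leading π R S := by
  obtain ⟨i, hi, hmin⟩ := Finset.exists_min_image S π ⟨j, hj⟩
  refine (hπ S i hi hmin j hj).trans ?_
  have := Finset.single_le_sum
    (f := fun i => if ∀ j ∈ S, π i ≤ π j then ch.fhat S i * R i else 0) (s := S)
    (fun k hk => by
      split_ifs
      · exact mul_nonneg (ch.fhat_nonneg hk) (hR k)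
      · exact le_rfl) hi
  rw [if_pos hmin] at this
  exact this

/-- Summed over all queues, the leading terms give one of the sums that define the outer
bound. -/
theorem sum_leading (π : Equiv.Perm (Fin N)) (R : Fin N → ℝ) :
    ∑ S, ch.leading π R S =
      ∑ k, R (π.symm k) / (1 - ch.eps ((Finset.Iic k).image π.symm)) := by
  have h1 : ∀ S, ch.leading π R S =
      ∑ i, if i ∈ S ∧ ∀ j ∈ S, π i ≤ π j then ch.fhat S i * R i else 0 := by
    intro S
    rw [leading, ← Finset.sum_filter_add_sum_filter_not Finset.univ (· ∈ S)]
    rw [Finset.sum_eq_zero (s := Finset.univ.filter (· ∉ S)), add_zero]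
    · rw [Finset.filter_univ_mem]
      exact Finset.sum_congr rfl fun i hi => by simp [hi]
    · intro i hi
      rw [if_neg]
      exact fun h => (Finset.mem_filter.1 hi).2 h.1
  simp only [h1]
  rw [Finset.sum_comm, ← Equiv.sum_comp π fun k =>
    R (π.symm k) / (1 - ch.eps ((Finset.Iic k).image π.symm))]
  refine Finset.sum_congr rfl fun i _ => ?_
  rw [Equiv.symm_apply_apply]
  have hA : Finset.univ \ Finset.univ.filter (fun j => π i < π j) =
      (Finset.Iic (π i)).image π.symm := by
    ext j
    simp only [Finset.mem_sdiff, Finset.mem_univ, true_and, Finset.mem_filter, not_lt,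
      Finset.mem_image, Finset.mem_Iic]
    exact ⟨fun h => ⟨π j, h, by simp⟩, by rintro ⟨k, hk, rfl⟩; simpa using hk⟩
  rw [← hA, div_eq_mul_one_div, ← ch.sum_fhat_insert (i := i) (by simp), Finset.mul_sum,
    ← Finset.sum_filter]
  refine Finset.sum_nbij' (fun S => S.erase i) (fun B => insert i B) ?_ ?_ ?_ ?_ ?_
  · intro S hS
    simp only [Finset.mem_filter, Finset.mem_univ, true_and] at hS
    rw [Finset.mem_powerset]
    intro j hj
    rw [Finset.mem_erase] at hj
    simp only [Finset.mem_filter, Finset.mem_univ, true_and]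
    exact lt_of_le_of_ne (hS.2 j hj.2) fun h => hj.1 (π.injective h).symm
  · intro B hB
    rw [Finset.mem_powerset] at hB
    simp only [Finset.mem_filter, Finset.mem_univ, true_and, Finset.mem_insert, true_or,
      forall_eq_or_imp, le_refl]
    intro j hj
    exact (Finset.mem_filter.1 (hB hj)).2.le
  · intro S hS
    simp only [Finset.mem_filter] at hS
    exact Finset.insert_erase hS.2.1
  · intro B hB
    rw [Finset.mem_powerset] at hB
    exact Finset.erase_insert fun h => by simpa using hB h
  · intro S hS
    simp only [Finset.mem_filter] at hS
    rw [Finset.insert_erase hS.2.1, mul_comm]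

theorem sum_leading_le {L : ℕ} {R : Fin N → ℝ} (hR : R ∈ ch.outerBound L)
    (π : Equiv.Perm (Fin N)) : ∑ S, ch.leading π R S ≤ L := by
  rw [sum_leading]
  exact hR.2 π.symm

end ErasureChannel

theorem FeedbackCode.avgErrorProb_nonneg {N : ℕ} {F : Type*} {M : Fin N → ℕ} {n : ℕ}
    (c : FeedbackCode F M n) (ch : ErasureChannel N) : 0 ≤ c.avgErrorProb ch := by
  refine div_nonneg (Finset.sum_nonneg fun w _ => Finset.sum_nonneg fun z _ => ?_) (by positivity)
  split_ifs
  · exact Finset.prod_nonneg fun t _ => ch.prob_nonneg _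
  · exact le_rfl

namespace Code1

/-- The number of packets for `⌈2 ^ x⌉` messages, where a packet has `L` bits. -/
theorem clog_ceil_le {q L : ℕ} (hL : 0 < L) (hq : q = 2 ^ L) {x : ℝ} (hx : 0 ≤ x) :
    (Nat.clog (q) ⌈(2 : ℝ) ^ x⌉₊ : ℝ) ≤ x / L + 1 := by
  have hLr : (0 : ℝ) < L := by exact_mod_cast hL
  have h1 : Nat.clog (q) ⌈(2 : ℝ) ^ x⌉₊ ≤ ⌈x / L⌉₊ := by
    refine Nat.clog_le_of_le_pow ?_
    rw [Nat.ceil_le, hq]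
    push_cast
    rw [← pow_mul, ← Real.rpow_natCast]
    refine Real.rpow_le_rpow_of_exponent_le (by norm_num) ?_
    push_cast
    have := Nat.le_ceil (x / L)
    rw [div_le_iff₀ hLr] at this
    linarith
  have h2 := Nat.ceil_lt_add_one (div_nonneg hx hLr.le)
  have h3 : (Nat.clog (q) ⌈(2 : ℝ) ^ x⌉₊ : ℝ) ≤ (⌈x / L⌉₊ : ℝ) := by exact_mod_cast h1
  linarith

variable {N : ℕ} {F : Type*} [Field F] [Fintype F]

theorem Rule.exists_mem_codes (rule : Rule N F) (M : Fin N → ℕ) (n : ℕ) :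
    ∃ c ∈ rule.codes M n, ∀ ch : ErasureChannel N,
      c.avgErrorProb ch ≤ rule.overrunProb ch (fun i => Nat.clog (Fintype.card F) (M i)) n := by
  have hφ : ∀ i, Nonempty (Fin (M i) ↪ (Fin (Nat.clog (Fintype.card F) (M i)) → F)) := by
    intro i
    refine Function.Embedding.nonempty_of_card_le ?_
    rw [Fintype.card_fin, Fintype.card_fun, Fintype.card_fin]
    exact Nat.le_pow_clog Fintype.one_lt_card _
  exact ⟨_, ⟨fun i => (hφ i).some, rfl⟩, fun ch => rule.avgErrorProb_code_le _ n ch⟩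

/-- Rates strictly inside the outer bound, in the direction of an ordered rate, are achievable:
the expected duration of the algorithm is the fraction `c` of the blocklength. -/
theorem Rule.achievableUnder_smul (rule : Rule N F) (ch : ErasureChannel N) {L : ℕ} (hL : 0 < L)
    (hF : Fintype.card F = 2 ^ L) {R : Fin N → ℝ} (hord : R ∈ ch.orderedRates)
    (hout : R ∈ ch.outerBound L) {c : ℝ} (hc0 : 0 ≤ c) (hc1 : c < 1) :
    ch.AchievableUnder rule.codes (c • R) := by
  obtain ⟨hR, π, hπ⟩ := hord
  have hLr : (0 : ℝ) < L := by exact_mod_cast hL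
  refine ⟨smul_nonneg hc0 hR, ?_⟩
  choose code hmem hle using fun n : ℕ => rule.exists_mem_codes
    (fun i => ⌈(2 : ℝ) ^ ((n : ℝ) * (c • R) i)⌉₊) n
  refine ⟨code, hmem, ?_⟩
  -- a budget of `δ n` slots of delay for every queue keeps the duration below `n`
  set Q : ℝ := (Fintype.card (Finset (Fin N)) : ℝ) with hQ
  have hQ0 : 0 < Q := by rw [hQ]; exact_mod_cast Fintype.card_pos
  set δ : ℝ := (1 - c) / (2 * Q) with hδ
  have hδ0 : 0 < δ := by rw [hδ]; exact div_pos (by linarith) (by positivity)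
  set V : ℝ := ∑ S, ∑ i ∈ S, ch.fhat S i with hV
  have hV0 : 0 ≤ V := Finset.sum_nonneg fun S _ => Finset.sum_nonneg fun i hi => ch.fhat_nonneg hi
  have hVle : ∀ S : Finset (Fin N), ∀ i ∈ S, ch.fhat S i ≤ V := fun S i hi =>
    (Finset.single_le_sum (f := fun i => ch.fhat S i) (fun i hi => ch.fhat_nonneg hi) hi).trans
      (Finset.single_le_sum (f := fun S : Finset (Fin N) => ∑ i ∈ S, ch.fhat S i)
        (fun S _ => Finset.sum_nonneg fun i hi => ch.fhat_nonneg hi) (Finset.mem_univ S))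
  set C : ℝ := ∑ S, ∑ i ∈ S, incrementBound ch i S ^ 2 with hC
  have hbound : ∀ᶠ n : ℕ in atTop, (code n).avgErrorProb ch ≤ C / δ ^ 2 * (1 / (n : ℝ)) := by
    have hlarge : ∀ᶠ n : ℕ in atTop, 2 * Q * V / (1 - c) < (n : ℝ) :=
      tendsto_natCast_atTop_atTop.eventually_gt_atTop _
    filter_upwards [hlarge, eventually_gt_atTop 0] with n hn hn0
    have hnr : (0 : ℝ) < n := by exact_mod_cast hn0
    refine (hle n ch).trans ?_
    have hdom := rule.overrunProb_le ch n (a := δ * n) (by positivity)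
      (K := fun i => Nat.clog (Fintype.card F) ⌈(2 : ℝ) ^ ((n : ℝ) * (c • R) i)⌉₊)
      (fun S => n * c / L * ch.leading π R S + V + δ * n) ?_ ?_
    · refine hdom.trans (le_of_eq ?_)
      rw [← hC]
      field_simp
    · intro S i hi
      have h1 := clog_ceil_le hL hF (x := n * (c • R) i)
        (mul_nonneg hnr.le (mul_nonneg hc0 (hR i)))
      have h2 := ch.fhat_mul_le_leading hR hπ hi
      have h3 := ch.fhat_nonneg hi
      have h4 := mul_le_mul_of_nonneg_right h1 h3
      have h5 : n * c / L * (ch.fhat S i * R i) ≤ n * c / L * ch.leading π R S :=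
        mul_le_mul_of_nonneg_left h2 (by positivity)
      have h6 : (n * (c • R) i / L + 1) * ch.fhat S i =
          n * c / L * (ch.fhat S i * R i) + ch.fhat S i := by
        simp only [Pi.smul_apply, smul_eq_mul]; ring
      have := hVle S i hi
      linarith
    · have hlead0 : ∀ S, 0 ≤ ch.leading π R S := by
        intro S
        refine Finset.sum_nonneg fun i hi => ?_
        split_ifs
        · exact mul_nonneg (ch.fhat_nonneg hi) (hR i)
        · exact le_rfl
      calc ∑ S with S.Nonempty, (n * c / L * ch.leading π R S + V + δ * n)
          ≤ ∑ S, (n * c / L * ch.leading π R S + V + δ * n) := by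
            refine Finset.sum_le_sum_of_subset_of_nonneg (Finset.filter_subset _ _) fun S _ _ => ?_
            have := hlead0 S
            positivity
        _ = n * c / L * ∑ S, ch.leading π R S + Q * V + Q * (δ * n) := by
            rw [Finset.sum_add_distrib, Finset.sum_add_distrib, ← Finset.mul_sum]
            simp [hQ]
        _ ≤ n * c / L * L + Q * V + Q * (δ * n) := by
            have := mul_le_mul_of_nonneg_left (ch.sum_leading_le hout π)
              (by positivity : 0 ≤ n * c / L)
            linarith
        _ < n := by
            have h1 : n * c / L * L = n * c := by field_simp
            have h2 : Q * (δ * n) = (1 - c) / 2 * n := by rw [hδ]; field_simp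
            rw [div_lt_iff₀ (by linarith)] at hn
            rw [h1, h2]
            nlinarith
  refine squeeze_zero' (Eventually.of_forall fun n => (code n).avgErrorProb_nonneg ch) hbound ?_
  simpa using tendsto_one_div_atTop_nhds_zero_nat.const_mul (C / δ ^ 2)

theorem Rule.inter_subset_rateRegion (rule : Rule N F) (ch : ErasureChannel N) {L : ℕ}
    (hL : 0 < L) (hF : Fintype.card F = 2 ^ L) :
    ch.orderedRates ∩ ch.outerBound L ⊆ ch.rateRegion rule.codes := by
  rintro R ⟨hord, hout⟩
  have hc : Tendsto (fun k : ℕ => 1 - 1 / ((k : ℝ) + 1)) atTop (𝓝 1) := by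
    simpa using tendsto_one_div_add_atTop_nhds_zero_nat.const_sub (1 : ℝ)
  have hlim : Tendsto (fun k : ℕ => (1 - 1 / ((k : ℝ) + 1)) • R) atTop (𝓝 R) := by
    simpa using hc.smul_const R
  refine mem_closure_of_tendsto hlim (Eventually.of_forall fun k => ?_)
  have hk : (0 : ℝ) < (k : ℝ) + 1 := by positivity
  refine rule.achievableUnder_smul ch hL hF hord hout ?_ ?_
  · rw [sub_nonneg, div_le_one hk]
    have : (0 : ℝ) ≤ k := Nat.cast_nonneg k
    linarith
  · have : 0 < 1 / ((k : ℝ) + 1) := by positivity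
    linarith

end Code1

/-! ### Entropy of partitions of a finite set -/

namespace Setoid

open Classical in
/-- The size of the class of `ω`. -/
noncomputable def classCard {Ω : Type*} [Fintype Ω] (r : Setoid Ω) (ω : Ω) : ℕ :=
  (Finset.univ.filter fun ω' => r ω ω').card

/-- The ambiguity of a partition: `|Ω|` times the conditional entropy of a uniformly distributed
element of `Ω`, given its class. -/
noncomputable def ambiguity {Ω : Type*} [Fintype Ω] (r : Setoid Ω) : ℝ :=
  ∑ ω, Real.log (r.classCard ω)

variable {Ω : Type*} [Fintype Ω]

theorem classCard_pos (r : Setoid Ω) (ω : Ω) : 0 < r.classCard ω := by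
  classical
  exact Finset.card_pos.2 ⟨ω, by simp⟩

theorem classCard_eq {r : Setoid Ω} {ω ω' : Ω} (h : r ω ω') : r.classCard ω = r.classCard ω' := by
  classical
  refine congrArg Finset.card (Finset.filter_congr fun x _ => ?_)
  exact ⟨fun hx => r.trans' (r.symm' h) hx, fun hx => r.trans' h hx⟩

theorem ambiguity_mono {r s : Setoid Ω} (h : s ≤ r) : s.ambiguity ≤ r.ambiguity := by
  classical
  refine Finset.sum_le_sum fun ω _ => Real.log_le_log (by exact_mod_cast s.classCard_pos ω) ?_
  exact_mod_cast Finset.card_le_card (Finset.monotone_filter_right _ fun x _ hx => h hx)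

/-- A set that lies in one class contributes at most one to the number of classes. -/
theorem sum_inv_classCard_le_one (r : Setoid Ω) {A : Finset Ω}
    (h : ∀ ω ∈ A, ∀ ω' ∈ A, r ω ω') : ∑ ω ∈ A, (1 : ℝ) / r.classCard ω ≤ 1 := by
  classical
  rcases A.eq_empty_or_nonempty with rfl | hA
  · simp
  have hcard : (0 : ℝ) < A.card := by exact_mod_cast Finset.card_pos.2 hA
  calc ∑ ω ∈ A, (1 : ℝ) / r.classCard ω ≤ ∑ _ω ∈ A, (1 : ℝ) / A.card := by
        refine Finset.sum_le_sum fun ω hω => one_div_le_one_div_of_le hcard ?_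
        exact_mod_cast Finset.card_le_card fun ω' hω' => by simpa using h ω hω ω' hω'
    _ = 1 := by rw [Finset.sum_const, nsmul_eq_mul]; field_simp

open Classical in
/-- The Gibbs inequality, in terms of partitions: weights `p` for which the `p ω / |class of ω|`,
with the classes of `s`, sum to at most one in every class of `r` bound the loss of ambiguity
from `r` to `s`. -/
theorem ambiguity_sub_le (r s : Setoid Ω) (p : Ω → ℝ) (hp : ∀ ω, 0 < p ω)
    (h : ∀ ω, ∑ ω' with r ω ω', p ω' / s.classCard ω' ≤ 1) :
    r.ambiguity - s.ambiguity ≤ -∑ ω, Real.log (p ω) := by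
  have hr : ∀ ω, (0 : ℝ) < r.classCard ω := fun ω => by exact_mod_cast r.classCard_pos ω
  have hs : ∀ ω, (0 : ℝ) < s.classCard ω := fun ω => by exact_mod_cast s.classCard_pos ω
  have h1 : ∀ ω, Real.log (r.classCard ω) - Real.log (s.classCard ω) + Real.log (p ω) ≤
      r.classCard ω * (p ω / s.classCard ω) - 1 := by
    intro ω
    rw [← Real.log_div (hr ω).ne' (hs ω).ne',
      ← Real.log_mul (div_pos (hr ω) (hs ω)).ne' (hp ω).ne']
    refine (Real.log_le_sub_one_of_pos (mul_pos (div_pos (hr ω) (hs ω)) (hp ω))).trans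
      (le_of_eq ?_)
    ring
  have h2 : ∑ ω, (r.classCard ω : ℝ) * (p ω / s.classCard ω) ≤ Fintype.card Ω := by
    calc ∑ ω, (r.classCard ω : ℝ) * (p ω / s.classCard ω)
        = ∑ ω, ∑ ω', if r ω ω' then p ω / s.classCard ω else 0 := by
          refine Finset.sum_congr rfl fun ω _ => ?_
          rw [← Finset.sum_filter, Finset.sum_const, nsmul_eq_mul, classCard]
      _ = ∑ ω', ∑ ω with r ω' ω, p ω / s.classCard ω := by
          rw [Finset.sum_comm]
          refine Finset.sum_congr rfl fun ω' _ => ?_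
          rw [Finset.sum_filter]
          refine Finset.sum_congr rfl fun ω _ => ?_
          simp only [Setoid.comm' r (x := ω) (y := ω')]
      _ ≤ ∑ _ω' : Ω, (1 : ℝ) := Finset.sum_le_sum fun ω' _ => h ω'
      _ = Fintype.card Ω := by simp
  have h3 := Finset.sum_le_sum fun ω (_ : ω ∈ Finset.univ) => h1 ω
  rw [Finset.sum_add_distrib, Finset.sum_sub_distrib, Finset.sum_sub_distrib] at h3
  simp only [Finset.sum_const, nsmul_eq_mul, mul_one, Finset.card_univ] at h3
  unfold ambiguity
  linarith

/-- Conditioning reduces entropy. -/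
theorem ambiguity_sub_inf_le {r s : Setoid Ω} (h : s ≤ r) (x : Setoid Ω) :
    s.ambiguity - (s ⊓ x).ambiguity ≤ r.ambiguity - (r ⊓ x).ambiguity := by
  classical
  have hr : ∀ ω, (0 : ℝ) < r.classCard ω := fun ω => by exact_mod_cast r.classCard_pos ω
  have hrx : ∀ ω, (0 : ℝ) < (r ⊓ x).classCard ω := fun ω => by
    exact_mod_cast (r ⊓ x).classCard_pos ω
  refine (ambiguity_sub_le s (s ⊓ x) (fun ω => (r ⊓ x).classCard ω / r.classCard ω)
    (fun ω => div_pos (hrx ω) (hr ω)) fun ω₀ => ?_).trans (le_of_eq ?_)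
  · calc ∑ ω with s ω₀ ω, ((r ⊓ x).classCard ω / r.classCard ω : ℝ) / (s ⊓ x).classCard ω
        = ∑ ω with s ω₀ ω, ∑ ω', (if (r ⊓ x) ω ω' then
            (1 : ℝ) / (s ⊓ x).classCard ω else 0) / r.classCard ω₀ := by
          refine Finset.sum_congr rfl fun ω hω => ?_
          rw [← classCard_eq (h (by simpa using hω)), ← Finset.sum_div, ← Finset.sum_filter,
            Finset.sum_const, nsmul_eq_mul, ← classCard]
          ring
      _ = ∑ ω', (∑ ω with s ω₀ ω ∧ (r ⊓ x) ω ω', (1 : ℝ) / (s ⊓ x).classCard ω) /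
            r.classCard ω₀ := by
          rw [Finset.sum_comm]
          refine Finset.sum_congr rfl fun ω' _ => ?_
          rw [← Finset.sum_div, ← Finset.sum_filter, Finset.filter_filter]
      _ ≤ ∑ ω' with r ω₀ ω', 1 / (r.classCard ω₀ : ℝ) := by
          rw [Finset.sum_filter]
          refine Finset.sum_le_sum fun ω' _ => ?_
          split_ifs with hω'
          · refine div_le_div_of_nonneg_right ?_ (hr ω₀).le
            refine sum_inv_classCard_le_one _ fun ω hω ω₁ hω₁ => ?_
            simp only [Finset.mem_filter, Finset.mem_univ, true_and] at hω hω₁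
            exact ⟨s.trans' (s.symm' hω.1) hω₁.1, x.trans' hω.2.2 (x.symm' hω₁.2.2)⟩
          · rw [Finset.sum_eq_zero, zero_div]
            intro ω hω
            simp only [Finset.mem_filter, Finset.mem_univ, true_and] at hω
            exact absurd (r.trans' (h hω.1) hω.2.1) hω'
      _ = 1 := by
          rw [Finset.sum_const, nsmul_eq_mul, ← classCard]
          have := (hr ω₀).ne'
          field_simp
  · unfold ambiguity
    rw [← Finset.sum_sub_distrib, ← Finset.sum_neg_distrib]
    refine Finset.sum_congr rfl fun ω _ => ?_
    rw [Real.log_div (hrx ω).ne' (hr ω).ne']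
    ring

theorem sum_inv_classCard_inf_ker_le {α : Type*} [Fintype α] (r : Setoid Ω) (X : Ω → α)
    {A : Finset Ω} (h : ∀ ω ∈ A, ∀ ω' ∈ A, r ω ω') :
    ∑ ω ∈ A, (1 : ℝ) / (r ⊓ Setoid.ker X).classCard ω ≤ Fintype.card α := by
  classical
  rw [← Finset.sum_fiberwise A X]
  refine (Finset.sum_le_sum (g := fun _ => (1 : ℝ)) fun a _ => ?_).trans (by simp)
  refine sum_inv_classCard_le_one _ fun ω hω ω' hω' => ?_
  rw [Finset.mem_filter] at hω hω'
  exact ⟨h ω hω.1 ω' hω'.1, hω.2.trans hω'.2.symm⟩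

/-- The entropy of a function is at most the logarithm of the number of its values. -/
theorem ambiguity_sub_inf_ker_le {α : Type*} [Fintype α] [Nonempty α] (r : Setoid Ω) (X : Ω → α) :
    r.ambiguity - (r ⊓ Setoid.ker X).ambiguity ≤ Fintype.card Ω * Real.log (Fintype.card α) := by
  classical
  have hα : (0 : ℝ) < Fintype.card α := by exact_mod_cast Fintype.card_pos
  refine (ambiguity_sub_le r _ (fun _ => 1 / Fintype.card α) (fun _ => by positivity)
    fun ω₀ => ?_).trans (le_of_eq ?_)
  · have := sum_inv_classCard_inf_ker_le r X (A := Finset.univ.filter fun ω => r ω₀ ω)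
      fun ω hω ω' hω' => by
        simp only [Finset.mem_filter, Finset.mem_univ, true_and] at hω hω'
        exact r.trans' (r.symm' hω) hω'
    calc _ = (1 / Fintype.card α : ℝ) *
          ∑ ω with r ω₀ ω, (1 : ℝ) / (r ⊓ Setoid.ker X).classCard ω := by
          rw [Finset.mul_sum]
          exact Finset.sum_congr rfl fun ω _ => by ring
      _ ≤ (1 / Fintype.card α : ℝ) * Fintype.card α :=
          mul_le_mul_of_nonneg_left this (by positivity)
      _ = 1 := by field_simp
  · simp

/-- Fano's inequality: if `X` is determined by the class outside the set `E` of errors, little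
ambiguity about `X` is left. -/
theorem ambiguity_sub_inf_ker_le_of_error {α : Type*} [Fintype α] [Nonempty α] (r : Setoid Ω)
    (X : Ω → α) (E : Finset Ω) (h : ∀ ω ∉ E, ∀ ω' ∉ E, r ω ω' → X ω = X ω') :
    r.ambiguity - (r ⊓ Setoid.ker X).ambiguity ≤
      Fintype.card Ω * Real.log 2 + E.card * Real.log (Fintype.card α) := by
  classical
  have hα : (0 : ℝ) < Fintype.card α := by exact_mod_cast Fintype.card_pos
  refine (ambiguity_sub_le r _ (fun ω => if ω ∈ E then 1 / (2 * Fintype.card α) else 1 / 2)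
    (fun ω => by split_ifs <;> positivity) fun ω₀ => ?_).trans (le_of_eq ?_)
  · have hr : ∀ ω ∈ Finset.univ.filter fun ω => r ω₀ ω,
        ∀ ω' ∈ Finset.univ.filter fun ω => r ω₀ ω, r ω ω' := fun ω hω ω' hω' => by
      simp only [Finset.mem_filter, Finset.mem_univ, true_and] at hω hω'
      exact r.trans' (r.symm' hω) hω'
    rw [← Finset.sum_filter_add_sum_filter_not _ (· ∈ E)]
    have h1 := sum_inv_classCard_inf_ker_le r X
      (A := (Finset.univ.filter fun ω => r ω₀ ω).filter (· ∈ E)) fun ω hω ω' hω' =>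
        hr ω (Finset.mem_of_mem_filter _ hω) ω' (Finset.mem_of_mem_filter _ hω')
    have h2 := sum_inv_classCard_le_one (r ⊓ Setoid.ker X)
      (A := (Finset.univ.filter fun ω => r ω₀ ω).filter (· ∉ E)) fun ω hω ω' hω' => by
        have hrr := hr ω (Finset.mem_of_mem_filter _ hω) ω' (Finset.mem_of_mem_filter _ hω')
        exact ⟨hrr, h ω (Finset.mem_filter.1 hω).2 ω' (Finset.mem_filter.1 hω').2 hrr⟩
    have e1 : ∑ ω ∈ (Finset.univ.filter fun ω => r ω₀ ω).filter (· ∈ E),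
        (if ω ∈ E then 1 / (2 * Fintype.card α) else 1 / 2 : ℝ) /
          (r ⊓ Setoid.ker X).classCard ω = (1 / (2 * Fintype.card α)) *
        ∑ ω ∈ (Finset.univ.filter fun ω => r ω₀ ω).filter (· ∈ E),
          (1 : ℝ) / (r ⊓ Setoid.ker X).classCard ω := by
      rw [Finset.mul_sum]
      refine Finset.sum_congr rfl fun ω hω => ?_
      rw [if_pos (Finset.mem_filter.1 hω).2]; ring
    have e2 : ∑ ω ∈ (Finset.univ.filter fun ω => r ω₀ ω).filter (· ∉ E),
        (if ω ∈ E then 1 / (2 * Fintype.card α) else 1 / 2 : ℝ) /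
          (r ⊓ Setoid.ker X).classCard ω = (1 / 2) *
        ∑ ω ∈ (Finset.univ.filter fun ω => r ω₀ ω).filter (· ∉ E),
          (1 : ℝ) / (r ⊓ Setoid.ker X).classCard ω := by
      rw [Finset.mul_sum]
      refine Finset.sum_congr rfl fun ω hω => ?_
      rw [if_neg (Finset.mem_filter.1 hω).2]; ring
    rw [e1, e2]
    have h3 : (1 / (2 * Fintype.card α) : ℝ) * Fintype.card α = 1 / 2 := by field_simp
    have h4 := mul_le_mul_of_nonneg_left h1
      (by positivity : (0 : ℝ) ≤ 1 / (2 * Fintype.card α))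
    linarith
  · have hlog : ∀ ω, -Real.log (if ω ∈ E then 1 / (2 * Fintype.card α) else 1 / 2 : ℝ) =
        Real.log 2 + if ω ∈ E then Real.log (Fintype.card α) else 0 := by
      intro ω
      split_ifs
      · rw [one_div, Real.log_inv, neg_neg, Real.log_mul two_ne_zero hα.ne']
      · rw [one_div, Real.log_inv, neg_neg, add_zero]
    rw [← Finset.sum_neg_distrib, Finset.sum_congr rfl fun ω _ => hlog ω, Finset.sum_add_distrib]
    simp

/-- The partition of message vectors according to the messages of the users in `J`. -/
def agree {ι : Type*} (M : ι → ℕ) (J : Finset ι) : Setoid ((i : ι) → Fin (M i)) where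
  r w w' := ∀ j ∈ J, w j = w' j
  iseqv := ⟨fun _ _ _ => rfl, fun h j hj => (h j hj).symm,
    fun h h' j hj => (h j hj).trans (h' j hj)⟩

theorem agree_insert {ι : Type*} [DecidableEq ι] (M : ι → ℕ) (J : Finset ι) (i : ι) :
    agree M (insert i J) = agree M J ⊓ Setoid.ker fun w => w i := by
  ext w w'
  constructor
  · exact fun h => ⟨fun j hj => h j (Finset.mem_insert_of_mem hj), h i (Finset.mem_insert_self i J)⟩
  · rintro ⟨h1, h2⟩ j hj
    rcases Finset.mem_insert.1 hj with rfl | hj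
    · exact h2
    · exact h1 j hj

/-- The message of user `i` is uniformly distributed given those of the users in `J`. -/
theorem card_mul_log_le_ambiguity_sub {ι : Type*} [Fintype ι] [DecidableEq ι] (M : ι → ℕ)
    {J : Finset ι} {i : ι} (hi : i ∉ J) (hM : 0 < M i) :
    Fintype.card ((i : ι) → Fin (M i)) * Real.log (M i) ≤
      (agree M J).ambiguity - (agree M (insert i J)).ambiguity := by
  classical
  have hcard : ∀ w, M i * (agree M (insert i J)).classCard w ≤ (agree M J).classCard w := by
    intro w
    have hinj : ((Finset.univ : Finset (Fin (M i))) ×ˢ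
        Finset.univ.filter fun w' => agree M (insert i J) w w').card ≤
        (Finset.univ.filter fun w' => agree M J w w').card := by
      refine Finset.card_le_card_of_injOn (fun p => Function.update p.2 i p.1) ?_ ?_
      · rintro ⟨m, w'⟩ hp
        simp only [Finset.coe_product, Set.mem_prod, Finset.mem_coe, Finset.mem_filter,
          Finset.mem_univ, true_and] at hp ⊢
        intro j hj
        rw [Function.update_of_ne (ne_of_mem_of_not_mem hj hi)]
        exact hp j (Finset.mem_insert_of_mem hj)
      · rintro ⟨m, w'⟩ hp ⟨m', w''⟩ hp' h
        simp only [Finset.coe_product, Set.mem_prod, Finset.mem_coe, Finset.mem_filter,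
          Finset.mem_univ, true_and] at hp hp' h
        have hm : m = m' := by simpa using congrFun h i
        refine Prod.ext hm (funext fun j => ?_)
        by_cases hj : j = i
        · subst hj
          exact (hp j (Finset.mem_insert_self j J)).symm.trans (hp' j (Finset.mem_insert_self j J))
        · simpa [Function.update_of_ne hj] using congrFun h j
    simpa [Finset.card_product, classCard] using hinj
  unfold ambiguity
  rw [← Finset.sum_sub_distrib, ← nsmul_eq_mul, ← Finset.card_univ, ← Finset.sum_const]
  refine Finset.sum_le_sum fun w _ => ?_
  have h1 : (0 : ℝ) < M i := by exact_mod_cast hM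
  have h2 : (0 : ℝ) < (agree M (insert i J)).classCard w := by
    exact_mod_cast (agree M (insert i J)).classCard_pos w
  rw [le_sub_iff_add_le, ← Real.log_mul h1.ne' h2.ne']
  exact Real.log_le_log (mul_pos h1 h2) (by exact_mod_cast hcard w)

end Setoid

/-! ### The outer bound holds for every code -/

namespace FeedbackCode

variable {N : ℕ} {F : Type*} {M : Fin N → ℕ} {n : ℕ}

/-- The packet that is transmitted in slot `l` as a function of the messages, if `z` lists the sets
of erasing users of the slots before. -/
def transmitted (c : FeedbackCode F M n) (l : ℕ) (z : Fin l → Finset (Fin N))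
    (w : (i : Fin N) → Fin (M i)) : F :=
  c.enc l w (c.outputs w l z)

open Classical in
/-- The partition of the message vectors according to all that the users of `I` together receive
in `l` slots, if `z` lists the sets of erasing users. -/
noncomputable def received (c : FeedbackCode F M n) (I : Finset (Fin N)) :
    (l : ℕ) → (Fin l → Finset (Fin N)) → Setoid ((i : Fin N) → Fin (M i))
  | 0, _ => ⊤
  | l + 1, z => c.received I l (fun t => z t.castSucc) ⊓
      if I ⊆ z (Fin.last l) then ⊤ else Setoid.ker (c.transmitted l fun t => z t.castSucc)

theorem received_anti (c : FeedbackCode F M n) {I J : Finset (Fin N)} (h : I ⊆ J) {l : ℕ}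
    (z : Fin l → Finset (Fin N)) : c.received J l z ≤ c.received I l z := by
  induction l with
  | zero => exact le_rfl
  | succ l ih =>
    refine inf_le_inf (ih _) ?_
    by_cases hI : I ⊆ z (Fin.last l)
    · simp [hI]
    · have hJ : ¬ J ⊆ z (Fin.last l) := fun hJ => hI (h.trans hJ)
      simp [hI, hJ]

theorem outputs_eq_of_received (c : FeedbackCode F M n) {I : Finset (Fin N)} {i : Fin N}
    (hi : i ∈ I) {l : ℕ} (z : Fin l → Finset (Fin N)) {w w' : (i : Fin N) → Fin (M i)}
    (h : c.received I l z w w') (t : Fin l) : c.outputs w l z t i = c.outputs w' l z t i := by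
  induction l with
  | zero => exact t.elim0
  | succ l ih =>
    obtain ⟨h1, h2⟩ := h
    rw [outputs, outputs]
    refine Fin.lastCases ?_ (fun t => ?_) t
    · rw [Fin.snoc_last, Fin.snoc_last]
      by_cases hz : i ∈ z (Fin.last l)
      · simp [channelOutput, hz]
      · rw [if_neg fun hI => hz (hI hi)] at h2
        simp only [channelOutput, if_neg hz]
        exact congrArg some h2
    · rw [Fin.snoc_castSucc, Fin.snoc_castSucc]
      exact ih _ h1 t

variable (c : FeedbackCode F M n) (ch : ErasureChannel N)

/-- The mean ambiguity that is left for the users of `I` after `l` slots, given `V`. -/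
noncomputable def remaining (V : Setoid ((i : Fin N) → Fin (M i))) (I : Finset (Fin N)) (l : ℕ) :
    ℝ :=
  ch.expect l fun z => (V ⊓ c.received I l z).ambiguity

/-- The mean loss of ambiguity of the users of `I` from the packet of slot `l`, given `V`, if they
received it. -/
noncomputable def innovation (V : Setoid ((i : Fin N) → Fin (M i))) (I : Finset (Fin N)) (l : ℕ) :
    ℝ :=
  ch.expect l fun z => (V ⊓ c.received I l z).ambiguity -
    (V ⊓ c.received I l z ⊓ Setoid.ker (c.transmitted l z)).ambiguity

theorem remaining_zero (V : Setoid ((i : Fin N) → Fin (M i))) (I : Finset (Fin N)) :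
    c.remaining ch V I 0 = V.ambiguity := by
  simp [remaining, ErasureChannel.expect, received]

theorem remaining_succ (V : Setoid ((i : Fin N) → Fin (M i))) (I : Finset (Fin N)) (l : ℕ) :
    c.remaining ch V I (l + 1) =
      c.remaining ch V I l - (1 - ch.eps I) * c.innovation ch V I l := by
  classical
  have hstep : ∀ (z : Fin l → Finset (Fin N)),
      ∑ Z, ch.prob Z * (V ⊓ c.received I (l + 1)
        (Fin.snoc (α := fun _ => Finset (Fin N)) z Z)).ambiguity =
      (V ⊓ c.received I l z).ambiguity + -(1 - ch.eps I) * ((V ⊓ c.received I l z).ambiguity -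
        (V ⊓ c.received I l z ⊓ Setoid.ker (c.transmitted l z)).ambiguity) := by
    intro z
    have hZ : ∀ Z, ch.prob Z * (V ⊓ c.received I (l + 1)
        (Fin.snoc (α := fun _ => Finset (Fin N)) z Z)).ambiguity =
        ch.prob Z * (V ⊓ c.received I l z ⊓ Setoid.ker (c.transmitted l z)).ambiguity +
        (if I ⊆ Z then ch.prob Z else 0) * ((V ⊓ c.received I l z).ambiguity -
          (V ⊓ c.received I l z ⊓ Setoid.ker (c.transmitted l z)).ambiguity) := by
      intro Z
      rw [received]
      simp only [Fin.snoc_castSucc, Fin.snoc_last]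
      by_cases hI : I ⊆ Z
      · rw [if_pos hI, if_pos hI, inf_top_eq]; ring
      · rw [if_neg hI, if_neg hI, ← inf_assoc]; ring
    rw [Finset.sum_congr rfl fun Z _ => hZ Z, Finset.sum_add_distrib, ← Finset.sum_mul,
      ← Finset.sum_mul, ch.prob_sum, ← Finset.sum_filter, ErasureChannel.eps]
    ring
  rw [remaining, ch.expect_succ]
  simp only [hstep]
  rw [ch.expect_add, ch.expect_const_mul, remaining, innovation]
  ring

theorem ambiguity_sub_remaining (V : Setoid ((i : Fin N) → Fin (M i))) (I : Finset (Fin N))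
    (l : ℕ) : V.ambiguity - c.remaining ch V I l =
      (1 - ch.eps I) * ∑ t ∈ Finset.range l, c.innovation ch V I t := by
  induction l with
  | zero => simp [remaining_zero]
  | succ l ih => rw [remaining_succ, Finset.sum_range_succ]; linarith

theorem innovation_nonneg (V : Setoid ((i : Fin N) → Fin (M i))) (I : Finset (Fin N)) (l : ℕ) :
    0 ≤ c.innovation ch V I l := by
  rw [← ch.expect_const (n := l) 0]
  exact ch.expect_mono fun z => sub_nonneg.2 (Setoid.ambiguity_mono inf_le_left)

theorem innovation_le [Fintype F] [Nonempty F] (V : Setoid ((i : Fin N) → Fin (M i)))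
    (I : Finset (Fin N)) (l : ℕ) : c.innovation ch V I l ≤
      Fintype.card ((i : Fin N) → Fin (M i)) * Real.log (Fintype.card F) := by
  rw [← ch.expect_const (n := l) (_ * _)]
  exact ch.expect_mono fun z => Setoid.ambiguity_sub_inf_ker_le _ _

/-- Users who receive less have more to learn from the next packet. -/
theorem innovation_anti (V : Setoid ((i : Fin N) → Fin (M i))) {I J : Finset (Fin N)} (h : I ⊆ J)
    (l : ℕ) : c.innovation ch V J l ≤ c.innovation ch V I l :=
  ch.expect_mono fun z => Setoid.ambiguity_sub_inf_le (inf_le_inf le_rfl (c.received_anti h z)) _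

/-- The users of `I ∋ i` decode the message of user `i` with an ambiguity that is small by Fano's
inequality. -/
theorem remaining_sub_le {J I : Finset (Fin N)} {i : Fin N} (hi : i ∈ I) (hM : ∀ j, 0 < M j) :
    c.remaining ch (Setoid.agree M J) I n - c.remaining ch (Setoid.agree M (insert i J)) I n ≤
      Fintype.card ((i : Fin N) → Fin (M i)) *
        (Real.log 2 + c.avgErrorProb ch * Real.log (M i)) := by
  classical
  have hcard : (0 : ℝ) < Fintype.card ((i : Fin N) → Fin (M i)) := by
    have : Nonempty ((i : Fin N) → Fin (M i)) := ⟨fun j => ⟨0, hM j⟩⟩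
    exact_mod_cast Fintype.card_pos
  have hne : Nonempty (Fin (M i)) := ⟨⟨0, hM i⟩⟩
  let E : (Fin n → Finset (Fin N)) → Finset ((i : Fin N) → Fin (M i)) := fun z =>
    Finset.univ.filter fun w => ∃ i, c.dec i (fun t => c.outputs w n z t i) z ≠ some (w i)
  have hE : ch.expect n (fun z => ((E z).card : ℝ)) =
      Fintype.card ((i : Fin N) → Fin (M i)) * c.avgErrorProb ch := by
    rw [avgErrorProb, mul_div_cancel₀ _ hcard.ne']
    simp only [errorProb]
    rw [Finset.sum_comm]
    refine Finset.sum_congr rfl fun z _ => ?_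
    rw [← Finset.sum_filter, Finset.sum_const, nsmul_eq_mul, mul_comm]
  have hz : ∀ z, (Setoid.agree M J ⊓ c.received I n z).ambiguity ≤
      (Setoid.agree M (insert i J) ⊓ c.received I n z).ambiguity +
        (Fintype.card ((i : Fin N) → Fin (M i)) * Real.log 2 +
          Real.log (M i) * (E z).card) := by
    intro z
    have hf := Setoid.ambiguity_sub_inf_ker_le_of_error (Setoid.agree M J ⊓ c.received I n z)
      (fun w => w i) (E z) ?_
    · rw [Setoid.agree_insert, inf_right_comm]
      rw [Fintype.card_fin] at hf
      linarith
    · rintro w hw w' hw' ⟨-, hr⟩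
      simp only [E, Finset.mem_filter, Finset.mem_univ, true_and, not_exists, ne_eq, not_not]
        at hw hw'
      have heq : (fun t => c.outputs w n z t i) = fun t => c.outputs w' n z t i :=
        funext fun t => c.outputs_eq_of_received hi z hr t
      have h1 := hw i
      rw [heq, hw' i] at h1
      exact (Option.some.inj h1).symm
  have h := ch.expect_mono hz
  rw [ch.expect_add, ch.expect_add, ch.expect_const, ch.expect_const_mul, hE] at h
  simp only [remaining]
  linarith

/-- The outer bound for a code of given blocklength. The users `π 1, …, π k` together form a
degraded channel; user by user, the loss of ambiguity per useful slot is telescoped. -/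
theorem sum_log_le [Fintype F] [Nonempty F] (hM : ∀ j, 0 < M j) (π : Equiv.Perm (Fin N)) :
    ∑ k, ((1 - c.avgErrorProb ch) * Real.log (M (π k)) - Real.log 2) /
      (1 - ch.eps ((Finset.Iic k).image π)) ≤ n * Real.log (Fintype.card F) := by
  classical
  have hcard : (0 : ℝ) < Fintype.card ((i : Fin N) → Fin (M i)) := by
    have : Nonempty ((i : Fin N) → Fin (M i)) := ⟨fun j => ⟨0, hM j⟩⟩
    exact_mod_cast Fintype.card_pos
  -- `J m` consists of the first `m` users
  let J : ℕ → Finset (Fin N) := fun m => (Finset.univ.filter fun k : Fin N => (k : ℕ) < m).image π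
  let T : ℕ → ℝ := fun m =>
    ∑ t ∈ Finset.range n, c.innovation ch (Setoid.agree M (J m)) (J (m + 1)) t
  have hJ : ∀ k : Fin N, J (k + 1) = (Finset.Iic k).image π := by
    intro k
    simp only [J]
    congr 1
    ext j
    simp only [Finset.mem_filter, Finset.mem_univ, true_and, Finset.mem_Iic, Fin.le_def]
    omega
  have hins : ∀ k : Fin N, J (k + 1) = insert (π k) (J k) := by
    intro k
    simp only [J]
    rw [← Finset.image_insert]
    congr 1
    ext j
    simp only [Finset.mem_filter, Finset.mem_univ, true_and, Finset.mem_insert, Fin.ext_iff]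
    omega
  have hnot : ∀ k : Fin N, π k ∉ J k := by
    intro k h
    obtain ⟨j, hj, hjk⟩ := Finset.mem_image.1 h
    rw [π.injective hjk] at hj
    simp at hj
  have hmono : ∀ m, J m ⊆ J (m + 1) := by
    intro m
    refine Finset.image_subset_image (f := π) fun j hj => ?_
    simp only [Finset.mem_filter, Finset.mem_univ, true_and] at hj ⊢
    omega
  have hterm : ∀ k : Fin N, ((1 - c.avgErrorProb ch) * Real.log (M (π k)) - Real.log 2) /
      (1 - ch.eps ((Finset.Iic k).image π)) ≤
        (T k - T (k + 1)) / Fintype.card ((i : Fin N) → Fin (M i)) := by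
    intro k
    have hpos : 0 < 1 - ch.eps ((Finset.Iic k).image π) :=
      ch.one_sub_eps_pos ⟨π k, Finset.mem_image_of_mem π (by simp)⟩
    have h1 := Setoid.card_mul_log_le_ambiguity_sub M (hnot k) (hM (π k))
    have h2 := c.remaining_sub_le ch (J := J k) (I := J (k + 1)) (i := π k)
      (by rw [hins]; exact Finset.mem_insert_self _ _) hM
    rw [← hins] at h1 h2
    have h3 := c.ambiguity_sub_remaining ch (Setoid.agree M (J k)) (J (k + 1)) n
    have h4 := c.ambiguity_sub_remaining ch (Setoid.agree M (J (k + 1))) (J (k + 1)) n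
    have h5 : T (k + 1) ≤
        ∑ t ∈ Finset.range n, c.innovation ch (Setoid.agree M (J (k + 1))) (J (k + 1)) t :=
      Finset.sum_le_sum fun t _ => c.innovation_anti ch _ (hmono _) t
    rw [div_le_div_iff₀ hpos hcard]
    rw [hJ k] at h3 h4 h2 h1 h5
    simp only [T, hJ k] at h5 ⊢
    have h6 := mul_le_mul_of_nonneg_left h5 hpos.le
    linarith
  have hT0 : T 0 ≤ n * (Fintype.card ((i : Fin N) → Fin (M i)) * Real.log (Fintype.card F)) := by
    refine (Finset.sum_le_sum fun t _ => c.innovation_le ch _ _ t).trans ?_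
    simp
  have hTN : 0 ≤ T N := Finset.sum_nonneg fun t _ => c.innovation_nonneg ch _ _ t
  calc _ ≤ ∑ k : Fin N, (T k - T (k + 1)) / Fintype.card ((i : Fin N) → Fin (M i)) :=
        Finset.sum_le_sum fun k _ => hterm k
    _ = (T 0 - T N) / Fintype.card ((i : Fin N) → Fin (M i)) := by
        rw [← Finset.sum_div, Fin.sum_univ_eq_sum_range (fun k => T k - T (k + 1)),
          Finset.sum_range_sub']
    _ ≤ _ := by
        rw [div_le_iff₀ hcard]
        linarith

end FeedbackCode

namespace ErasureChannel

variable {N : ℕ}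

theorem isClosed_outerBound (ch : ErasureChannel N) (L : ℕ) : IsClosed (ch.outerBound L) := by
  have : ch.outerBound L = {R | 0 ≤ R} ∩ ⋂ π : Equiv.Perm (Fin N),
      {R | ∑ i, R (π i) / (1 - ch.eps ((Finset.Iic i).image π)) ≤ L} := by
    ext R; simp [outerBound]
  rw [this]
  refine (isClosed_le continuous_const continuous_id).inter (isClosed_iInter fun π => ?_)
  exact isClosed_le (continuous_finsetSum _ fun i _ => (continuous_apply _).div_const _)
    continuous_const

variable {F : Type*}

theorem rateRegion_subset_capacityRegion (ch : ErasureChannel N) (𝔠 : CodeClass N F) :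
    ch.rateRegion 𝔠 ⊆ ch.capacityRegion F :=
  closure_mono fun _ h => ⟨𝔠, h⟩

variable [Fintype F] [Nonempty F]

theorem AchievableUnder.mem_outerBound {ch : ErasureChannel N} {𝔠 : CodeClass N F}
    {R : Fin N → ℝ} (h : ch.AchievableUnder 𝔠 R) {L : ℕ} (hF : Fintype.card F = 2 ^ L) :
    R ∈ ch.outerBound L := by
  obtain ⟨hR, c, -, hlim⟩ := h
  refine ⟨hR, fun π => ?_⟩
  have hlog2 : 0 < Real.log 2 := Real.log_pos one_lt_two
  have hlim' : Tendsto (fun n : ℕ => ∑ k, ((1 - (c n).avgErrorProb ch) * R (π k) - 1 / (n : ℝ)) /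
      (1 - ch.eps ((Finset.Iic k).image π))) atTop
      (𝓝 (∑ k, ((1 - 0) * R (π k) - 0) / (1 - ch.eps ((Finset.Iic k).image π)))) :=
    tendsto_finsetSum _ fun k _ => ((((tendsto_const_nhds.sub hlim).mul_const _).sub
      tendsto_one_div_atTop_nhds_zero_nat).div_const _)
  simp only [sub_zero, one_mul] at hlim'
  refine le_of_tendsto hlim' ?_
  filter_upwards [eventually_gt_atTop 0, hlim.eventually_lt_const one_pos] with n hn hlt
  have hnr : (0 : ℝ) < n := by exact_mod_cast hn
  have hx : ∀ j, (0 : ℝ) < 2 ^ ((n : ℝ) * R j) := fun j => Real.rpow_pos_of_pos two_pos _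
  have hb := (c n).sum_log_le ch (fun j => Nat.ceil_pos.2 (hx j)) π
  rw [hF] at hb
  push_cast at hb
  rw [Real.log_pow] at hb
  rw [← mul_le_mul_iff_right₀ (mul_pos hnr hlog2), Finset.mul_sum]
  refine le_trans (Finset.sum_le_sum fun k _ => ?_) (hb.trans (le_of_eq (by ring)))
  have hpos : 0 < 1 - ch.eps ((Finset.Iic k).image π) :=
    ch.one_sub_eps_pos ⟨π k, Finset.mem_image_of_mem π (by simp)⟩
  rw [← mul_div_assoc]
  refine div_le_div_of_nonneg_right ?_ hpos.le
  have hlog : n * R (π k) * Real.log 2 ≤ Real.log (⌈(2 : ℝ) ^ ((n : ℝ) * R (π k))⌉₊ : ℝ) := by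
    rw [← Real.log_rpow two_pos]
    exact Real.log_le_log (hx _) (Nat.le_ceil _)
  have := mul_le_mul_of_nonneg_left hlog (sub_nonneg.2 hlt.le)
  have e : n * Real.log 2 * ((1 - (c n).avgErrorProb ch) * R (π k) - 1 / n) =
      (1 - (c n).avgErrorProb ch) * (n * R (π k) * Real.log 2) - Real.log 2 := by
    field_simp
  rw [e]
  linarith

theorem capacityRegion_subset_outerBound (ch : ErasureChannel N) {L : ℕ}
    (hF : Fintype.card F = 2 ^ L) : ch.capacityRegion F ⊆ ch.outerBound L :=
  closure_minimal (fun _ ⟨_, h⟩ => h.mem_outerBound hF) (ch.isClosed_outerBound L)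

end ErasureChannel

/-! ### Ordered rates of symmetric and of spatially independent channels -/

namespace ErasureChannel

variable {N : ℕ} {ch : ErasureChannel N}

theorem Symmetric.fhat_eq (h : ch.Symmetric) {S : Finset (Fin N)} {i j : Fin N} (hi : i ∈ S)
    (hj : j ∈ S) : ch.fhat S i = ch.fhat S j := by
  classical
  obtain ⟨g, hg⟩ : ∃ g : ℕ → ℝ, ∀ H : Finset (Fin N), ch.eps (Finset.univ \ H) = g H.card := by
    refine ⟨fun m => if hm : ∃ H : Finset (Fin N), H.card = m then
      ch.eps (Finset.univ \ hm.choose) else 0, fun H => ?_⟩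
    have hm : ∃ H' : Finset (Fin N), H'.card = H.card := ⟨H, rfl⟩
    beta_reduce
    rw [dif_pos hm]
    refine h _ _ ?_
    rw [Finset.card_sdiff_of_subset (Finset.subset_univ _),
      Finset.card_sdiff_of_subset (Finset.subset_univ _), hm.choose_spec]
  have hsum : ∀ k ∈ S, ch.fhat S k = ∑ m ∈ Finset.range (S.card - 1 + 1),
      (S.card - 1).choose m • ((-1) ^ (S.card - m - 1) / (1 - g m)) := by
    intro k hk
    rw [fhat]
    simp only [hg]
    rw [Finset.sum_powerset_apply_card (fun m => (-1 : ℝ) ^ (S.card - m - 1) / (1 - g m)),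
      Finset.card_erase_of_mem hk]
  rw [hsum i hi, hsum j hj]

/-- Since `f̂^i_S` does not depend on `i`, the users are ordered by their rates. -/
theorem Symmetric.orderedRates_eq (h : ch.Symmetric) : ch.orderedRates = {R | 0 ≤ R} := by
  refine Set.Subset.antisymm (fun R hR => hR.1) fun R hR => ⟨hR, ?_⟩
  refine ⟨(Tuple.sort fun k => -R k).symm, fun S i hi hmin j hj => ?_⟩
  have hle := Tuple.monotone_sort (fun k => -R k) (hmin j hj)
  simp only [Function.comp_apply, Equiv.apply_symm_apply, neg_le_neg_iff] at hle
  rw [h.fhat_eq hj hi]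
  exact mul_le_mul_of_nonneg_left hle (ch.fhat_nonneg hi)

/-- The `t`-th summand is the probability that, after `t` slots, the users of `S` other than `i`
have received a packet, and no other user has. -/
theorem SpatiallyIndependent.hasSum_fhat (h : ch.SpatiallyIndependent) {S : Finset (Fin N)}
    {i : Fin N} (hi : i ∈ S) :
    HasSum (fun t : ℕ => (∏ k ∈ Finset.univ \ S, ch.eps {k} ^ t) * ch.eps {i} ^ t *
      ∏ k ∈ S.erase i, (1 - ch.eps {k} ^ t)) (ch.fhat S i) := by
  classical
  have hterm : ∀ t : ℕ, (∏ k ∈ Finset.univ \ S, ch.eps {k} ^ t) * ch.eps {i} ^ t *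
      ∏ k ∈ S.erase i, (1 - ch.eps {k} ^ t) =
      ∑ H ∈ (S.erase i).powerset, (-1) ^ (S.card - H.card - 1) * ch.eps (Finset.univ \ H) ^ t := by
    intro t
    simp only [sub_eq_add_neg]
    rw [Finset.prod_add, Finset.mul_sum]
    refine Finset.sum_congr rfl fun H hH => ?_
    rw [Finset.mem_powerset] at hH
    have hHS : H ⊆ S := hH.trans (Finset.erase_subset i S)
    have hiH : i ∉ H := fun h => Finset.notMem_erase i S (hH h)
    have hset : Finset.univ \ H = (Finset.univ \ S) ∪ insert i (S.erase i \ H) := by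
      ext k
      simp only [Finset.mem_sdiff, Finset.mem_univ, true_and, Finset.mem_union,
        Finset.mem_insert, Finset.mem_erase]
      have h1 : k ∈ H → k ∈ S := fun hk => hHS hk
      by_cases hk : k = i
      · subst hk; simp [hiH]
      · tauto
    have hdisj : Disjoint (Finset.univ \ S) (insert i (S.erase i \ H)) := by
      rw [Finset.disjoint_left]
      intro k hk hk'
      rw [Finset.mem_sdiff] at hk
      rcases Finset.mem_insert.1 hk' with rfl | hk'
      · exact hk.2 hi
      · exact hk.2 (Finset.mem_of_mem_erase (Finset.mem_sdiff.1 hk').1)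
    rw [h (Finset.univ \ H), hset, Finset.prod_union hdisj,
      Finset.prod_insert (fun h => Finset.notMem_erase i S (Finset.mem_sdiff.1 h).1),
      Finset.prod_neg, Finset.card_sdiff_of_subset hH, Finset.card_erase_of_mem hi,
      mul_pow, mul_pow, ← Finset.prod_pow, ← Finset.prod_pow,
      show S.card - H.card - 1 = S.card - 1 - H.card by omega, Finset.prod_const_one]
    ring
  simp only [hterm]
  rw [fhat]
  refine hasSum_sum fun H hH => ?_
  rw [Finset.mem_powerset] at hH
  rw [div_eq_mul_inv]
  refine (hasSum_geometric_of_lt_one (ch.eps_nonneg _) (ch.eps_lt_one ⟨i, ?_⟩)).mul_left _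
  simpa using fun h => Finset.notMem_erase i S (hH h)

theorem mul_pow_mul_one_sub_pow_le {x y : ℝ} (hy : 0 ≤ y) (hyx : y ≤ x) (hx : x ≤ 1) (t : ℕ) :
    x * (y ^ t * (1 - x ^ t)) ≤ y * (x ^ t * (1 - y ^ t)) := by
  rcases t with _ | t
  · simp
  have hx0 := hy.trans hyx
  have h1 : y ^ t ≤ x ^ t := pow_le_pow_left₀ hy hyx t
  have h2 : y ^ (t + 1) ≤ x ^ (t + 1) := pow_le_pow_left₀ hy hyx _
  have h3 : x ^ (t + 1) ≤ 1 := pow_le_one₀ hx0 hx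
  have h4 : y ^ t * (1 - x ^ (t + 1)) ≤ x ^ t * (1 - y ^ (t + 1)) :=
    mul_le_mul h1 (by linarith) (by linarith) (pow_nonneg hx0 t)
  have h5 := mul_le_mul_of_nonneg_left h4 (mul_nonneg hx0 hy)
  calc x * (y ^ (t + 1) * (1 - x ^ (t + 1))) = x * y * (y ^ t * (1 - x ^ (t + 1))) := by ring
    _ ≤ x * y * (x ^ t * (1 - y ^ (t + 1))) := h5
    _ = _ := by ring

/-- Termwise comparison of the series for `f̂^i_S` and `f̂^j_S`. -/
theorem SpatiallyIndependent.mul_fhat_le (h : ch.SpatiallyIndependent) {S : Finset (Fin N)}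
    {i j : Fin N} (hi : i ∈ S) (hj : j ∈ S) (hij : i ≠ j) (hle : ch.eps {j} ≤ ch.eps {i}) :
    ch.eps {i} * ch.fhat S j ≤ ch.eps {j} * ch.fhat S i := by
  refine hasSum_le (fun t => ?_) ((h.hasSum_fhat hj).mul_left _) ((h.hasSum_fhat hi).mul_left _)
  have hx : ∀ k, ch.eps {k} ≤ 1 := fun k => (ch.eps_lt_one (Finset.singleton_nonempty k)).le
  have hP : 0 ≤ ∏ k ∈ Finset.univ \ S, ch.eps {k} ^ t :=
    Finset.prod_nonneg fun k _ => pow_nonneg (ch.eps_nonneg _) t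
  have hW : 0 ≤ ∏ k ∈ (S.erase i).erase j, (1 - ch.eps {k} ^ t) :=
    Finset.prod_nonneg fun k _ => sub_nonneg.2 (pow_le_one₀ (ch.eps_nonneg _) (hx k))
  rw [← Finset.mul_prod_erase (S.erase i) _ (Finset.mem_erase.2 ⟨hij.symm, hj⟩),
    ← Finset.mul_prod_erase (S.erase j) _ (Finset.mem_erase.2 ⟨hij, hi⟩),
    Finset.erase_right_comm (a := j) (b := i)]
  have := mul_le_mul_of_nonneg_left
    (mul_pow_mul_one_sub_pow_le (ch.eps_nonneg {j}) hle (hx i) t) (mul_nonneg hP hW)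
  calc _ = (∏ k ∈ Finset.univ \ S, ch.eps {k} ^ t) *
        (∏ k ∈ (S.erase i).erase j, (1 - ch.eps {k} ^ t)) *
        (ch.eps {i} * (ch.eps {j} ^ t * (1 - ch.eps {i} ^ t))) := by ring
    _ ≤ _ := this
    _ = _ := by ring

theorem SpatiallyIndependent.fhat_eq_zero (h : ch.SpatiallyIndependent) {S : Finset (Fin N)}
    {i j : Fin N} (hi : i ∈ S) (hj : j ∈ S) (hij : i ≠ j) (h0 : ch.eps {j} = 0) :
    ch.fhat S j = 0 := by
  refine (h.hasSum_fhat hj).unique (hasSum_zero.congr_fun fun t => ?_)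
  rcases t with _ | t
  · rw [Finset.prod_eq_zero (Finset.mem_erase.2 ⟨hij, hi⟩), mul_zero]
    simp
  · simp [h0]

theorem SpatiallyIndependent.fairRates_subset (h : ch.SpatiallyIndependent)
    (hanti : Antitone fun i => ch.eps {i}) : ch.fairRates ⊆ ch.orderedRates := by
  rintro R ⟨hR, hfair⟩
  refine ⟨hR, Equiv.refl _, fun S i hi hmin j hj => ?_⟩
  have hij : i ≤ j := hmin j hj
  rcases hij.eq_or_lt with rfl | hlt
  · exact le_rfl
  have hfi := ch.fhat_nonneg hi
  have hfj := ch.fhat_nonneg hj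
  have hle : ch.eps {j} ≤ ch.eps {i} := hanti hij
  rcases (ch.eps_nonneg {j}).eq_or_lt with h0 | h0
  · rw [h.fhat_eq_zero hi hj hlt.ne h0.symm, zero_mul]
    exact mul_nonneg hfi (hR i)
  · have hi0 : 0 < ch.eps {i} := h0.trans_le hle
    have h1 : ch.eps {j} * R j ≤ ch.eps {i} * R i := hfair hij
    have h2 := h.mul_fhat_le hi hj hlt.ne hle
    have h3 := mul_le_mul_of_nonneg_left h1 (mul_nonneg hi0.le hfj)
    have h4 := mul_le_mul_of_nonneg_right h2 (mul_nonneg hi0.le (hR i))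
    refine le_of_mul_le_mul_left ?_ (mul_pos hi0 h0)
    linarith

end ErasureChannel

theorem mainTheorem4 {N L : ℕ} (hL : N < 2 ^ L) {F : Type*} [Field F] [Fintype F]
    (hF : Fintype.card F = 2 ^ L) (ch : ErasureChannel N) :
    Nonempty (Code1.Rule N F) ∧
    (ch.Symmetric →
      ch.orderedRates = {R | 0 ≤ R} ∧
      ∀ rule : Code1.Rule N F,
        ch.rateRegion rule.codes = ch.outerBound L ∧
        ch.rateRegion rule.codes = ch.capacityRegion F) ∧
    (ch.SpatiallyIndependent → (Antitone fun i => ch.eps {i}) →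
      ch.fairRates ⊆ ch.orderedRates ∧
      ∀ rule : Code1.Rule N F,
        ch.fairRates ∩ ch.outerBound L ⊆ ch.rateRegion rule.codes) := by
  have hL0 : 0 < L := by
    have := Fintype.one_lt_card (α := F)
    rw [hF] at this
    exact Nat.pos_of_ne_zero fun h => by simp [h] at this
  refine ⟨Code1.Rule.nonempty (hF ▸ hL), fun hsym => ⟨hsym.orderedRates_eq, fun rule => ?_⟩,
    fun hind hanti => ⟨hind.fairRates_subset hanti, fun rule => ?_⟩⟩
  · have h1 : ch.outerBound L ⊆ ch.rateRegion rule.codes := fun R hR =>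
      rule.inter_subset_rateRegion ch hL0 hF ⟨hsym.orderedRates_eq ▸ hR.1, hR⟩
    have h2 := ch.rateRegion_subset_capacityRegion rule.codes
    have h3 := ch.capacityRegion_subset_outerBound hF
    exact ⟨(h2.trans h3).antisymm h1, h2.antisymm (h3.trans h1)⟩
  · exact fun R hR => rule.inter_subset_rateRegion ch hL0 hF
      ⟨hind.fairRates_subset hanti hR.1, hR.2⟩
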